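/- Let $n_1,n_2,n_3,n_5\ge 0$ be integers, $n_4=n_1$ and $n=n_1+n_2+n_3+n_4+n_5$. Let $E,J,R\in\mathbb R^{n\times n}$ with $E=E^T\ge 0$, $J=-J^T$, $R=R^T\ge 0$, and suppose that the LTI dissipative Hamiltonian DAE $E\dot z=(J-R)z$ is in staircase form, i.e., partitioned into blocks of sizes $n_1,n_2,n_3,n_4,n_5$ (blocks may be void), $$E=\begin{bmatrix}E_{11}&E_{12}&0&0&0\\E_{21}&E_{22}&0&0&0\\0&0&0&0&0\\0&0&0&0&0\\0&0&0&0&0\end{bmatrix},\qquad J-R=\begin{bmatrix}J_{11}-R_{11}&J_{12}-R_{12}&J_{13}-R_{13}&J_{14}&0\\J_{21}-R_{21}&J_{22}-R_{22}&J_{23}-R_{23}&0&0\\J_{31}-R_{31}&J_{32}-R_{32}&J_{33}-R_{33}&0&0\\J_{41}&0&0&0&0\\0&0&0&0&0\end{bmatrix},$$ where $\begin{bmatrix}E_{11}&E_{12}\\E_{21}&E_{22}\end{bmatrix}$ is symmetric positive definite and $J_{33}-R_{33}$ and $J_{41}=-J_{14}^T$ are nonsingular. Let $t_0<t_1$. A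 solution on $[t_0,t_1]$ is a $C^1$ function $z:[t_0,t_1]\to\mathbb R^n$ satisfying the equation at every point; an initial value $z_0$ is consistent if the initial value problem with $z(t_0)=z_0$ has a solution. The index of a matrix pencil $\lambda E-A$ is the size of the largest nilpotent block (block belonging to the eigenvalue $\infty$) in its Kronecker canonical form over $\mathbb C$, and $0$ if there is no such block. (i) The initial value problem has exactly one solution for every consistent initial value if and only if $n_5=0$. If $n_5\ne0$, then the fifth block $z_5$ of the state can be chosen arbitrarily: replacing $z_5$ in any solution $z$ by any $w\in C^1([t_0,t_1],\mathbb R^{n_5})$ gives again a solution (with the fifth block of the initial value replaced by $w(t_0)$). (ii) The pencil $\lambda E-(J-R)$ is singular, i.e. $\det(\lambda E-(J-R))=0$ for all $\lambda\in\mathbb C$, if and only if $\ker E\cap\ker J\cap\ker R\neq\{0\}$. (iii) The (Kronecker) index of $\lambda E-(J-R)$ is well defined. It is $0$ if and only if $n_1=n_4=0$ and $n_3=0$; it is $1$ if and only if $n_1=n_4=0$ and $n_3>0$; and it is $2$ if and only if $n_1=n_4>0$. In particular it is at most two. -/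

import Mathlib

open Set Matrix

/-! ## Linear time-invariant differential-algebraic equations -/

/-- `z` is a (classical) solution of `E ż = A z` on the interval `[t₀, t₁]`: it is continuously
differentiable there and satisfies the equation at every point (with one-sided derivatives at the
end points). -/
structure IsDAESolution {ι : Type*} [Fintype ι] (E A : Matrix ι ι ℝ) (t₀ t₁ : ℝ)
    (z : ℝ → ι → ℝ) : Prop where
  contDiffOn : ContDiffOn ℝ 1 z (Icc t₀ t₁)
  eqn : ∀ t ∈ Icc t₀ t₁, E *ᵥ derivWithin z (Icc t₀ t₁) t = A *ᵥ z t

/-- `z` solves the initial value problem `E ż = A z`, `z(t₀) = z₀` on `[t₀, t₁]`. -/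
def IsIVPSolution {ι : Type*} [Fintype ι] (E A : Matrix ι ι ℝ) (t₀ t₁ : ℝ)
    (z₀ : ι → ℝ) (z : ℝ → ι → ℝ) : Prop :=
  IsDAESolution E A t₀ t₁ z ∧ z t₀ = z₀

/-- The initial value `z₀` is consistent: the initial value problem has at least one solution. -/
def IsConsistentInit {ι : Type*} [Fintype ι] (E A : Matrix ι ι ℝ) (t₀ t₁ : ℝ)
    (z₀ : ι → ℝ) : Prop :=
  ∃ z : ℝ → ι → ℝ, IsIVPSolution E A t₀ t₁ z₀ z

/-- For every consistent initial value, the initial value problem has exactly one solution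
(as a function on `[t₀, t₁]`). -/
def IsUniquelySolvable {ι : Type*} [Fintype ι] (E A : Matrix ι ι ℝ) (t₀ t₁ : ℝ) : Prop :=
  ∀ z₀ : ι → ℝ, IsConsistentInit E A t₀ t₁ z₀ →
    ∃ z : ℝ → ι → ℝ, IsIVPSolution E A t₀ t₁ z₀ z ∧
      ∀ z' : ℝ → ι → ℝ, IsIVPSolution E A t₀ t₁ z₀ z' → EqOn z' z (Icc t₀ t₁)

/-! ## Matrix pencils, Kronecker canonical form, Kronecker index -/

/-- The square pencil `λ E - A` is regular: its determinant does not vanish identically on `ℂ`. -/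
def IsRegularPencil {ι : Type*} [Fintype ι] [DecidableEq ι] (E A : Matrix ι ι ℂ) : Prop :=
  ∃ c : ℂ, (c • E - A).det ≠ 0

/-- Strong equivalence of pencils: `S (λ E₁ - A₁) T = λ E₂ - A₂` for all `λ ∈ ℂ`, with
nonsingular `S` and `T`. -/
def StronglyEquivalent {m n : Type*} [Fintype m] [DecidableEq m] [Fintype n] [DecidableEq n]
    (E₁ A₁ E₂ A₂ : Matrix m n ℂ) : Prop :=
  ∃ (S : Matrix m m ℂ) (T : Matrix n n ℂ), IsUnit S ∧ IsUnit T ∧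
    ∀ c : ℂ, S * (c • E₁ - A₁) * T = c • E₂ - A₂

/-- The four types of blocks of the Kronecker canonical form. -/
inductive KroneckerBlock : Type
  /-- the block `L_ε`, of size `ε × (ε + 1)` -/
  | singL (ε : ℕ) : KroneckerBlock
  /-- the block `L_ηᵀ`, of size `(η + 1) × η` -/
  | singLT (η : ℕ) : KroneckerBlock
  /-- the Jordan block of size `ρ × ρ` for the finite eigenvalue `μ` -/
  | jordan (ρ : ℕ+) (μ : ℂ) : KroneckerBlock
  /-- the nilpotent block `N_σ` of size `σ × σ` (eigenvalue infinity) -/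
  | nilp (σ : ℕ+) : KroneckerBlock

namespace KroneckerBlock

/-- Number of rows of a block. -/
def rows : KroneckerBlock → ℕ
  | singL ε => ε
  | singLT η => η + 1
  | jordan ρ _ => ρ
  | nilp σ => σ

/-- Number of columns of a block. -/
def cols : KroneckerBlock → ℕ
  | singL ε => ε + 1
  | singLT η => η
  | jordan ρ _ => ρ
  | nilp σ => σ

/-- The matrix `E` of the pencil `λ E - A` that forms the block. -/
def matE (b : KroneckerBlock) : Matrix (Fin b.rows) (Fin b.cols) ℂ :=
  Matrix.of fun i j =>
    match b with
    | singL _ => if (j : ℕ) = i then 1 else 0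
    | singLT _ => if (i : ℕ) = j then 1 else 0
    | jordan _ _ => if (i : ℕ) = j then 1 else 0
    | nilp _ => if (j : ℕ) = i + 1 then 1 else 0

/-- The matrix `A` of the pencil `λ E - A` that forms the block. -/
def matA (b : KroneckerBlock) : Matrix (Fin b.rows) (Fin b.cols) ℂ :=
  Matrix.of fun i j =>
    match b with
    | singL _ => if (j : ℕ) = i + 1 then 1 else 0
    | singLT _ => if (i : ℕ) = j + 1 then 1 else 0
    | jordan _ μ => if (i : ℕ) = j then μ else if (j : ℕ) = i + 1 then 1 else 0
    | nilp _ => if (i : ℕ) = j then 1 else 0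

/-- The size of a nilpotent block; blocks of the other types count as `0`. -/
def nilpSize : KroneckerBlock → ℕ
  | nilp σ => σ
  | _ => 0

end KroneckerBlock

/-- The blocks `b 0, …, b (k - 1)` (in any order) form the Kronecker canonical form of the pencil
`λ E - A`. The bijections `e`, `f` only number the rows and columns of the block diagonal pencil
by the index types of `E` and `A`. -/
def IsKroneckerForm {m n : Type*} [Fintype m] [DecidableEq m] [Fintype n] [DecidableEq n]
    (E A : Matrix m n ℂ) {k : ℕ} (b : Fin k → KroneckerBlock) : Prop :=
  ∃ (e : m ≃ Σ i, Fin (b i).rows) (f : n ≃ Σ i, Fin (b i).cols),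
    StronglyEquivalent E A
      ((Matrix.blockDiagonal' fun i => (b i).matE).submatrix e f)
      ((Matrix.blockDiagonal' fun i => (b i).matA).submatrix e f)

/-- `ν` is the (Kronecker) index of the pencil `λ E - A`: the size of the largest nilpotent block
in its Kronecker canonical form, and `0` if there is no such block (as when `E` is invertible). -/
def IsKroneckerIndex {m n : Type*} [Fintype m] [DecidableEq m] [Fintype n] [DecidableEq n]
    (E A : Matrix m n ℂ) (ν : ℕ) : Prop :=
  ∃ (k : ℕ) (b : Fin k → KroneckerBlock), IsKroneckerForm E A b ∧
    ν = Finset.univ.sup fun i => (b i).nilpSize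

/-! ## Dissipative Hamiltonian DAEs in staircase form -/

/-- The coefficients of an LTI dissipative Hamiltonian DAE `E ż = (J - R) z`. Over `ℝ`,
`PosSemidef` means symmetric and positive semidefinite. -/
structure IsDHDAE {ι : Type*} (E J R : Matrix ι ι ℝ) : Prop where
  E_posSemidef : E.PosSemidef
  J_skew : Jᵀ = -J
  R_posSemidef : R.PosSemidef

/-- Index set of five consecutive blocks of sizes `n₁, n₂, n₃, n₄ = n₁, n₅`. -/
abbrev StairIdx (n₁ n₂ n₃ n₅ : ℕ) : Type :=
  Fin n₁ ⊕ Fin n₂ ⊕ Fin n₃ ⊕ Fin n₁ ⊕ Fin n₅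

namespace StairIdx

variable {n₁ n₂ n₃ n₅ : ℕ}

/-- Indices of the first block. -/
def b1 (i : Fin n₁) : StairIdx n₁ n₂ n₃ n₅ := Sum.inl i

/-- Indices of the second block. -/
def b2 (i : Fin n₂) : StairIdx n₁ n₂ n₃ n₅ := Sum.inr (Sum.inl i)

/-- Indices of the third block. -/
def b3 (i : Fin n₃) : StairIdx n₁ n₂ n₃ n₅ := Sum.inr (Sum.inr (Sum.inl i))

/-- Indices of the fourth block. -/
def b4 (i : Fin n₁) : StairIdx n₁ n₂ n₃ n₅ := Sum.inr (Sum.inr (Sum.inr (Sum.inl i)))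

/-- Indices of the fifth block. -/
def b5 (i : Fin n₅) : StairIdx n₁ n₂ n₃ n₅ := Sum.inr (Sum.inr (Sum.inr (Sum.inr i)))

/-- Indices of the first two blocks together. -/
def b12 : Fin n₁ ⊕ Fin n₂ → StairIdx n₁ n₂ n₃ n₅ := Sum.elim b1 b2

/-- Indices of the last three blocks together. -/
def b345 : Fin n₃ ⊕ Fin n₁ ⊕ Fin n₅ → StairIdx n₁ n₂ n₃ n₅ := fun i => Sum.inr (Sum.inr i)

/-- Replace the fifth block of the vector `z` by `w`. -/
def replace5 (z : StairIdx n₁ n₂ n₃ n₅ → ℝ) (w : Fin n₅ → ℝ) : StairIdx n₁ n₂ n₃ n₅ → ℝ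
  | Sum.inr (Sum.inr (Sum.inr (Sum.inr i))) => w i
  | i => z i

end StairIdx

open StairIdx in
/-- The dissipative Hamiltonian DAE `E ż = (J - R) z` is in staircase form
```
    [ E₁₁ E₁₂ 0 0 0 ]            [ J₁₁-R₁₁ J₁₂-R₁₂ J₁₃-R₁₃ J₁₄ 0 ]
    [ E₂₁ E₂₂ 0 0 0 ]            [ J₂₁-R₂₁ J₂₂-R₂₂ J₂₃-R₂₃  0  0 ]
E = [  0   0  0 0 0 ],   J - R = [ J₃₁-R₃₁ J₃₂-R₃₂ J₃₃-R₃₃  0  0 ]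
    [  0   0  0 0 0 ]            [  J₄₁      0       0      0  0 ]
    [  0   0  0 0 0 ]            [   0       0       0      0  0 ]
```
with block sizes `n₁, n₂, n₃, n₄ = n₁, n₅` (blocks may be void), the leading two by two block part
of `E` positive definite, and `J₃₃ - R₃₃` and `J₄₁ = -J₁₄ᵀ` nonsingular. -/
structure IsStaircase {n₁ n₂ n₃ n₅ : ℕ}
    (E J R : Matrix (StairIdx n₁ n₂ n₃ n₅) (StairIdx n₁ n₂ n₃ n₅) ℝ) : Prop
    extends IsDHDAE E J R where
  E_lead : (E.submatrix b12 b12).PosDef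
  E_top : E.submatrix b12 b345 = 0
  E_bot : E.submatrix b345 id = 0
  A_24 : (J - R).submatrix b2 b4 = 0
  A_34 : (J - R).submatrix b3 b4 = 0
  A_44 : (J - R).submatrix b4 b4 = 0
  A_42 : (J - R).submatrix b4 b2 = 0
  A_43 : (J - R).submatrix b4 b3 = 0
  A_col5 : (J - R).submatrix id b5 = 0
  A_row5 : (J - R).submatrix b5 id = 0
  R_14 : R.submatrix b1 b4 = 0
  R_41 : R.submatrix b4 b1 = 0
  A_33 : IsUnit ((J - R).submatrix b3 b3)
  J_41 : IsUnit (J.submatrix b4 b1)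

/-!
Write `A = J - R`. Everything rests on a dissipation argument at `λ = 1`: pairing `E v = A v` with
`v` gives `vᵀ E v + vᵀ R v = 0`, so `ker (E - A) = ker E ∩ ker J ∩ ker R`
(`IsDHDAE.mulVec_eq_zero_of_eq`). This settles the singularity of the pencil without using the
staircase form. In staircase form this common kernel is the fifth block
(`IsStaircase.eq_zero_of_ker`).

*Solutions.* The energy `dᵀ E d` of the difference `d` of two solutions with the same initial value
is nonnegative, nonincreasing and starts at `0`. Hence `E d = 0`, and after differentiation
`A d = 0`, so `d` lives in the fifth block (`IsDHDAE.mulVec_sub_eq_zero`). As `E` and `A` ignore that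
block, it is arbitrary.

*Existence of the Kronecker form.* The pencil is the sum of a zero pencil on the fifth block and a
pencil with `E - A` invertible. The latter is strongly equivalent to `λ M - (M - 1)` with
`M = (E - A)⁻¹ E`, and the Jordan form of `M` decouples it into blocks in which either `M` or `M - 1`
can be normalized to the identity; a second Jordan form finishes
(`hasKroneckerForm_of_isUnit_sub`). The Jordan form itself comes from the structure theorem for
torsion modules over `ℂ[X]` (`exists_jordan_basis`).

*The index.* A nilpotent block of size `s` yields a chain `E x₁ = 0`, `A x₁ = E x₂`, …,
`A x_{s-1} = E x_s` with `A x₁ ≠ 0`. In staircase form, the chains of length three do not exist, those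
of length two exist iff `n₁ > 0`, and if `n₁ = 0`, those of length one exist iff `n₃ > 0`. Conversely
chains force nilpotent blocks, because `ker (E - A) ⊆ ker E` excludes blocks `L_ε` with `ε > 0`, the
only other blocks containing such chains. So the index of any Kronecker form is determined by the
block sizes (`IsStaircase.index_trichotomy`).
-/

/-! ### Jordan canonical form -/

section Jordan

open Polynomial DirectSum

/-- A chain `g v₀ = 0`, `g v_{j+1} = v_j` with `v₀ ≠ 0` is linearly independent. The vector `v₀` is
the one with index `0`; stating it for all `j` of value `0` covers the empty chain. -/
theorem linearIndependent_of_chain {K V : Type*} [Field K] [AddCommGroup V] [Module K V]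
    (g : V →ₗ[K] V) {n : ℕ} (v : Fin n → V) (h0 : ∀ j : Fin n, (j : ℕ) = 0 → v j ≠ 0 ∧ g (v j) = 0)
    (hs : ∀ i j : Fin n, (j : ℕ) = i + 1 → g (v j) = v i) : LinearIndependent K v := by
  induction n with
  | zero => exact linearIndependent_empty_type
  | succ n ih =>
    have ih' := ih (fun j => v j.castSucc) (fun j hj => h0 _ (by simpa using hj))
      (fun i j hij => hs _ _ (by simpa using hij))
    rw [Fintype.linearIndependent_iff] at ih' ⊢
    intro c hc
    have key : ∀ j : Fin n, c j.succ = 0 := by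
      apply ih' (fun j => c j.succ)
      have := congrArg g hc
      rw [map_sum, Fin.sum_univ_succ, map_smul, (h0 0 rfl).2, smul_zero, zero_add, map_zero] at this
      rw [← this]
      refine Finset.sum_congr rfl fun j _ => ?_
      rw [map_smul, hs j.castSucc j.succ (by simp)]
    intro j
    rw [Fin.sum_univ_succ] at hc
    simp only [key, zero_smul, Finset.sum_const_zero, add_zero, smul_eq_zero] at hc
    rcases Fin.eq_zero_or_eq_succ j with rfl | ⟨i, rfl⟩
    · exact hc.resolve_right (h0 0 rfl).1
    · exact key i

/-- In `ℂ[X] ⧸ ((X - μ) ^ e)` the powers of `X - μ`, in descending order, form a Jordan chain. -/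
theorem exists_chain_basis_quotient (μ : ℂ) (e : ℕ) :
    ∃ b : Module.Basis (Fin e) ℂ (ℂ[X] ⧸ Ideal.span {(X - C μ) ^ e}),
      (∀ j : Fin e, (j : ℕ) = 0 → (X - C μ) • b j = 0) ∧
      ∀ i j : Fin e, (j : ℕ) = i + 1 → (X - C μ) • b j = b i := by
  set q : ℂ[X] := (X - C μ) ^ e with hq
  have hmonic : q.Monic := (monic_X_sub_C μ).pow e
  let v : Fin e → ℂ[X] ⧸ Ideal.span {q} := fun j =>
    Ideal.Quotient.mk _ ((X - C μ) ^ (e - 1 - (j : ℕ)))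
  have smul_mk : ∀ p r : ℂ[X], p • (Ideal.Quotient.mk (Ideal.span {q}) r) =
      Ideal.Quotient.mk (Ideal.span {q}) (p * r) := fun p r => rfl
  have h0 : ∀ j : Fin e, (j : ℕ) = 0 → (X - C μ) • v j = 0 := by
    intro j hj
    simp only [v]
    rw [smul_mk, Ideal.Quotient.eq_zero_iff_mem, Ideal.mem_span_singleton, hq, ← pow_succ']
    exact pow_dvd_pow _ (by omega)
  have hs : ∀ i j : Fin e, (j : ℕ) = i + 1 → (X - C μ) • v j = v i := by
    intro i j hij
    simp only [v]
    rw [smul_mk, ← pow_succ']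
    congr 2
    omega
  have hli : LinearIndependent ℂ v := by
    refine linearIndependent_of_chain
      ((LinearMap.lsmul ℂ[X] (ℂ[X] ⧸ Ideal.span {q}) (X - C μ)).restrictScalars ℂ) v
      (fun j hj => ⟨?_, h0 j hj⟩) hs
    simp only [v]
    rw [Ne, Ideal.Quotient.eq_zero_iff_mem, Ideal.mem_span_singleton, hq,
      pow_dvd_pow_iff (X_sub_C_ne_zero μ) (not_isUnit_X_sub_C μ)]
    have := j.2
    omega
  let pb := AdjoinRoot.powerBasis' hmonic
  have hdeg : q.natDegree = e := by rw [hq, natDegree_pow, natDegree_X_sub_C, mul_one]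
  have hfr : Module.finrank ℂ (ℂ[X] ⧸ Ideal.span {q}) = e := by
    have := pb.finrank
    rw [AdjoinRoot.powerBasis'_dim, hdeg] at this
    exact this
  have hcard : Fintype.card (Fin e) = Module.finrank ℂ (ℂ[X] ⧸ Ideal.span {q}) := by
    rw [hfr, Fintype.card_fin]
  by_cases he : Nonempty (Fin e)
  · refine ⟨basisOfLinearIndependentOfCardEqFinrank hli hcard, ?_, ?_⟩
    · simpa using h0
    · simpa using hs
  -- the case `e = 0`, where the quotient is trivial
  · have : IsEmpty (Fin e) := not_nonempty_iff.1 he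
    have : Module.Finite ℂ (ℂ[X] ⧸ Ideal.span {q}) := pb.finite
    have : Subsingleton (ℂ[X] ⧸ Ideal.span {q}) := by
      apply Module.finrank_zero_iff (R := ℂ).1
      rw [hfr, ← Fintype.card_fin e, Fintype.card_eq_zero_iff]
      assumption
    exact ⟨Module.Basis.empty _, fun j => isEmptyElim j, fun i => isEmptyElim i⟩

/-- Existence of a Jordan basis, from the structure theorem for the torsion `ℂ[X]`-module `V` on
which `X` acts as `f`: it is a sum of modules `ℂ[X] ⧸ (p ^ e)` with `p` irreducible, hence linear.
Blocks of size `0` may occur. -/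
theorem exists_jordan_basis {V : Type*} [AddCommGroup V] [Module ℂ V] [FiniteDimensional ℂ V]
    (f : V →ₗ[ℂ] V) :
    ∃ (κ : Type) (_ : Fintype κ) (ρ : κ → ℕ) (μ : κ → ℂ) (b : Module.Basis (Σ i, Fin (ρ i)) ℂ V),
      (∀ i (j : Fin (ρ i)), (j : ℕ) = 0 → f (b ⟨i, j⟩) = μ i • b ⟨i, j⟩) ∧
      ∀ i (j k : Fin (ρ i)), (k : ℕ) = j + 1 → f (b ⟨i, k⟩) = μ i • b ⟨i, k⟩ + b ⟨i, j⟩ := by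
  classical
  have htors : Module.IsTorsion ℂ[X] (Module.AEval' f) := by
    intro x
    have hint : f.charpoly ≠ 0 := f.charpoly_monic.ne_zero
    refine ⟨⟨f.charpoly, mem_nonZeroDivisors_of_ne_zero hint⟩, ?_⟩
    change f.charpoly • x = 0
    apply (Module.AEval'.of f).symm.injective
    rw [Module.AEval.of_symm_smul, LinearMap.aeval_self_charpoly, zero_smul, map_zero]
  obtain ⟨κ, hκ, p, hp, e, ⟨Φ⟩⟩ := Module.equiv_directSum_of_isTorsion htors
  have hassoc : ∀ i, ∃ μ : ℂ, Ideal.span {p i ^ e i} = Ideal.span {(X - C μ) ^ e i} := by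
    intro i
    obtain ⟨μ, hμ⟩ := IsAlgClosed.exists_root (p i) (degree_pos_of_irreducible (hp i)).ne'
    refine ⟨μ, ?_⟩
    have : Associated (X - C μ) (p i) :=
      (irreducible_X_sub_C μ).associated_of_dvd (hp i) (dvd_iff_isRoot.2 hμ)
    rw [Ideal.span_singleton_eq_span_singleton]
    exact (this.pow_pow).symm
  choose μ hμ using hassoc
  choose b hb0 hbs using fun i => exists_chain_basis_quotient (μ i) (e i)
  let Ψ : Module.AEval' f ≃ₗ[ℂ[X]] ((i : κ) → (ℂ[X] ⧸ Ideal.span {(X - C (μ i)) ^ e i})) :=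
    (Φ.trans (DirectSum.linearEquivFunOnFintype ℂ[X] κ _)).trans
      (LinearEquiv.piCongrRight fun i => Submodule.quotEquivOfEq _ _ (hμ i))
  let B : Module.Basis (Σ i, Fin (e i)) ℂ ((i : κ) → (ℂ[X] ⧸ Ideal.span {(X - C (μ i)) ^ e i})) :=
    Pi.basis b
  have hB : ∀ i j, B ⟨i, j⟩ = Pi.single i (b i j) := fun i j => Pi.basis_apply b ⟨i, j⟩
  let B' := (B.map (Ψ.restrictScalars ℂ).symm).map (Module.AEval'.of f).symm
  have hB' : ∀ s, B' s = (Module.AEval'.of f).symm (Ψ.symm (B s)) := fun s => rfl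
  have hfB : ∀ s, f (B' s) = (Module.AEval'.of f).symm (Ψ.symm ((X : ℂ[X]) • B s)) := by
    intro s
    rw [map_smul, Module.AEval'.of_symm_X_smul]
    rfl
  have hX : ∀ i j, (X : ℂ[X]) • B ⟨i, j⟩ = μ i • B ⟨i, j⟩ + Pi.single i ((X - C (μ i)) • b i j) := by
    intro i j
    rw [hB, ← Pi.single_smul, ← Pi.single_smul, ← Pi.single_add, sub_smul,
      ← algebraMap_smul ℂ[X] (μ i) (b i j), Polynomial.algebraMap_eq, add_sub_cancel]
  have hΨ : ∀ (c : ℂ) x, Ψ.symm (c • x) = c • Ψ.symm x := (Ψ.restrictScalars ℂ).symm.map_smul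
  refine ⟨κ, hκ, e, μ, B', fun i j hj => ?_, fun i j k hk => ?_⟩
  · rw [hfB, hX, hb0 i j hj, Pi.single_zero, add_zero, hΨ, map_smul, hB']
  · rw [hfB, hX, hbs i j k hk, ← hB, map_add, map_add, hΨ, map_smul, hB', hB']

end Jordan

/-- The upper triangular Jordan block of size `n` (possibly `0`) with eigenvalue `μ`. -/
def jordanBlock (n : ℕ) (μ : ℂ) : Matrix (Fin n) (Fin n) ℂ :=
  Matrix.of fun i j => if (i : ℕ) = j then μ else if (j : ℕ) = i + 1 then 1 else 0

/-- Jordan canonical form of a complex matrix, in the form `M P = P D`; the bijection `e` numbers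
the rows and columns of the block diagonal matrix `D`. -/
theorem exists_jordan_form {n : Type*} [Fintype n] [DecidableEq n] (M : Matrix n n ℂ) :
    ∃ (κ : Type) (_ : Fintype κ) (_ : DecidableEq κ) (ρ : κ → ℕ) (μ : κ → ℂ)
      (e : n ≃ Σ i, Fin (ρ i)) (P : Matrix n n ℂ), IsUnit P ∧
      M * P = P * (blockDiagonal' fun i => jordanBlock (ρ i) (μ i)).submatrix e e := by
  classical
  obtain ⟨κ, hκ, ρ, μ, b, hb0, hbs⟩ := exists_jordan_basis (Matrix.toLin' M)
  let e : n ≃ Σ i, Fin (ρ i) := (Pi.basisFun ℂ n).indexEquiv b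
  let b' : Module.Basis n ℂ (n → ℂ) := b.reindex e.symm
  have hb' : ∀ x, b' x = b (e x) := fun x => by simp [b']
  refine ⟨κ, hκ, inferInstance, ρ, μ, e, (Pi.basisFun ℂ n).toMatrix b', ?_, ?_⟩
  · exact IsUnit.of_mul_eq_one _ ((Pi.basisFun ℂ n).toMatrix_mul_toMatrix_flip b')
  · have hD : (blockDiagonal' fun i => jordanBlock (ρ i) (μ i)).submatrix e e =
        LinearMap.toMatrix b' b' (Matrix.toLin' M) := by
      ext x y
      rw [LinearMap.toMatrix_apply, hb', submatrix_apply]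
      have hrepr : ∀ s t, b.repr (b s) t = if s = t then 1 else 0 := fun s t => by
        rw [b.repr_self, Finsupp.single_apply]
      have hr' : ∀ v, b'.repr v x = b.repr v (e x) := fun v => by simp [b']
      rw [hr']
      obtain ⟨i, r⟩ := e x
      obtain ⟨j, c⟩ := e y
      by_cases hc : (c : ℕ) = 0
      · rw [hb0 j c hc, map_smul, Finsupp.smul_apply, hrepr]
        by_cases hij : i = j
        · subst hij
          rw [blockDiagonal'_apply_eq]
          simp [jordanBlock, hc, Fin.ext_iff, eq_comm]
        · rw [blockDiagonal'_apply_ne _ _ _ hij, if_neg, smul_zero]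
          intro h; exact hij (congrArg Sigma.fst h).symm
      · have hk : (c : ℕ) = (⟨c - 1, by omega⟩ : Fin (ρ j)) + 1 := by simp; omega
        rw [hbs j _ c hk, map_add, map_smul, Finsupp.add_apply, Finsupp.smul_apply, hrepr, hrepr]
        by_cases hij : i = j
        · subst hij
          rw [blockDiagonal'_apply_eq]
          simp only [jordanBlock, of_apply, Sigma.mk.injEq, heq_eq_eq, true_and, Fin.ext_iff]
          have h1 : ((c : ℕ) = r + 1) ↔ (c : ℕ) - 1 = r := by omega
          simp only [h1, eq_comm (a := (r : ℕ))]
          by_cases h2 : (c : ℕ) = r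
          · simp [h2]
            omega
          · simp [h2]
        · have hne : ∀ c' : Fin (ρ j), ¬ ((⟨j, c'⟩ : Σ i, Fin (ρ i)) = ⟨i, r⟩) := by
            intro c' h; exact hij (congrArg Sigma.fst h).symm
          rw [blockDiagonal'_apply_ne _ _ _ hij, if_neg (hne _), if_neg (hne _)]
          simp
    rw [hD, basis_toMatrix_mul_linearMap_toMatrix, ← linearMap_toMatrix_mul_basis_toMatrix b' (Pi.basisFun ℂ n) (Pi.basisFun ℂ n),
      LinearMap.toMatrix_eq_toMatrix', LinearMap.toMatrix'_toLin']

/-! ### Pencils with a Kronecker canonical form -/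

section Pencil

variable {m n : Type*} [Fintype m] [DecidableEq m] [Fintype n] [DecidableEq n]

theorem StronglyEquivalent.of_mul_eq {E₁ A₁ E₂ A₂ : Matrix m n ℂ} (S : Matrix m m ℂ)
    (T : Matrix n n ℂ) (hS : IsUnit S) (hT : IsUnit T) (hE : S * E₁ * T = E₂)
    (hA : S * A₁ * T = A₂) : StronglyEquivalent E₁ A₁ E₂ A₂ :=
  ⟨S, T, hS, hT, fun c => by
    rw [Matrix.mul_sub, Matrix.sub_mul, Matrix.mul_smul, Matrix.smul_mul, hE, hA]⟩

theorem StronglyEquivalent.exists_mul_eq {E₁ A₁ E₂ A₂ : Matrix m n ℂ}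
    (h : StronglyEquivalent E₁ A₁ E₂ A₂) :
    ∃ (S : Matrix m m ℂ) (T : Matrix n n ℂ), IsUnit S ∧ IsUnit T ∧
      S * E₁ * T = E₂ ∧ S * A₁ * T = A₂ := by
  obtain ⟨S, T, hS, hT, h⟩ := h
  have h0 : S * A₁ * T = A₂ := by simpa using h 0
  refine ⟨S, T, hS, hT, ?_, h0⟩
  have h1 := h 1
  rwa [one_smul, one_smul, Matrix.mul_sub, Matrix.sub_mul, h0, sub_left_inj] at h1

theorem StronglyEquivalent.trans {E₁ A₁ E₂ A₂ E₃ A₃ : Matrix m n ℂ}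
    (h : StronglyEquivalent E₁ A₁ E₂ A₂) (h' : StronglyEquivalent E₂ A₂ E₃ A₃) :
    StronglyEquivalent E₁ A₁ E₃ A₃ := by
  obtain ⟨S, T, hS, hT, h⟩ := h
  obtain ⟨S', T', hS', hT', h'⟩ := h'
  refine ⟨S' * S, T * T', hS'.mul hS, hT.mul hT', fun c => ?_⟩
  rw [← h', ← h]
  simp only [Matrix.mul_assoc]

theorem StronglyEquivalent.submatrix {m' n' : Type*} [Fintype m'] [DecidableEq m']
    [Fintype n'] [DecidableEq n'] {E₁ A₁ E₂ A₂ : Matrix m n ℂ}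
    (h : StronglyEquivalent E₁ A₁ E₂ A₂) (e : m' ≃ m) (f : n' ≃ n) :
    StronglyEquivalent (E₁.submatrix e f) (A₁.submatrix e f)
      (E₂.submatrix e f) (A₂.submatrix e f) := by
  obtain ⟨S, T, hS, hT, hE, hA⟩ := h.exists_mul_eq
  refine .of_mul_eq (S.submatrix e e) (T.submatrix f f) ((Matrix.isUnit_submatrix_equiv e e).2 hS)
    ((Matrix.isUnit_submatrix_equiv f f).2 hT) ?_ ?_
  · rw [submatrix_mul_equiv, submatrix_mul_equiv, hE]
  · rw [submatrix_mul_equiv, submatrix_mul_equiv, hA]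

theorem isUnit_blockDiagonal' {κ : Type*} [Fintype κ] [DecidableEq κ] {m : κ → Type*}
    [∀ i, Fintype (m i)] [∀ i, DecidableEq (m i)] {S : ∀ i, Matrix (m i) (m i) ℂ}
    (hS : ∀ i, IsUnit (S i)) : IsUnit (blockDiagonal' S) :=
  (IsUnit.map (blockDiagonal'RingHom m ℂ) (Pi.isUnit_iff.2 hS) :)

theorem StronglyEquivalent.blockDiagonal' {κ : Type*} [Fintype κ] [DecidableEq κ]
    {m n : κ → Type*} [∀ i, Fintype (m i)] [∀ i, DecidableEq (m i)]
    [∀ i, Fintype (n i)] [∀ i, DecidableEq (n i)] {E₁ A₁ E₂ A₂ : ∀ i, Matrix (m i) (n i) ℂ}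
    (h : ∀ i, StronglyEquivalent (E₁ i) (A₁ i) (E₂ i) (A₂ i)) :
    StronglyEquivalent (Matrix.blockDiagonal' E₁) (Matrix.blockDiagonal' A₁)
      (Matrix.blockDiagonal' E₂) (Matrix.blockDiagonal' A₂) := by
  choose S T hS hT hE hA using fun i => (h i).exists_mul_eq
  refine .of_mul_eq _ _ (isUnit_blockDiagonal' hS) (isUnit_blockDiagonal' hT) ?_ ?_
  · rw [← blockDiagonal'_mul, ← blockDiagonal'_mul]
    exact congrArg _ (funext hE)
  · rw [← blockDiagonal'_mul, ← blockDiagonal'_mul]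
    exact congrArg _ (funext hA)

/-- The pencil `λ E - A` has a Kronecker canonical form. -/
def HasKroneckerForm (E A : Matrix m n ℂ) : Prop :=
  ∃ (k : ℕ) (b : Fin k → KroneckerBlock), IsKroneckerForm E A b

theorem HasKroneckerForm.of_stronglyEquivalent {E₁ A₁ E₂ A₂ : Matrix m n ℂ}
    (h : HasKroneckerForm E₂ A₂) (hs : StronglyEquivalent E₁ A₁ E₂ A₂) :
    HasKroneckerForm E₁ A₁ := by
  obtain ⟨k, b, e, f, h⟩ := h
  exact ⟨k, b, e, f, hs.trans h⟩

theorem HasKroneckerForm.submatrix {m' n' : Type*} [Fintype m'] [DecidableEq m']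
    [Fintype n'] [DecidableEq n'] {E A : Matrix m n ℂ} (h : HasKroneckerForm E A)
    (e : m' ≃ m) (f : n' ≃ n) : HasKroneckerForm (E.submatrix e f) (A.submatrix e f) := by
  obtain ⟨k, b, e', f', h⟩ := h
  exact ⟨k, b, e.trans e', f.trans f', h.submatrix e f⟩

theorem blockDiagonal'_reindex {κ κ' : Type*} [DecidableEq κ] [DecidableEq κ'] (g : κ' ≃ κ)
    {m n : κ → Type*} (M : ∀ i, Matrix (m i) (n i) ℂ) :
    (blockDiagonal' fun i => M (g i)) = (blockDiagonal' M).submatrix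
      (Equiv.sigmaCongrLeft (β := m) g) (Equiv.sigmaCongrLeft (β := n) g) := by
  ext ⟨i, r⟩ ⟨j, c⟩
  rw [submatrix_apply]
  by_cases hij : i = j
  · subst hij
    rw [blockDiagonal'_apply_eq]
    exact (blockDiagonal'_apply_eq _ _ _ _).symm
  · rw [blockDiagonal'_apply_ne _ _ _ hij]
    exact (blockDiagonal'_apply_ne _ _ _ (g.injective.ne hij)).symm

/-- The blocks of a Kronecker canonical form may be indexed by any finite type. -/
theorem HasKroneckerForm.of_fintype {κ : Type*} [Fintype κ] [DecidableEq κ]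
    {E A : Matrix m n ℂ} (b : κ → KroneckerBlock) (e : m ≃ Σ i, Fin (b i).rows)
    (f : n ≃ Σ i, Fin (b i).cols)
    (h : StronglyEquivalent E A
      ((Matrix.blockDiagonal' fun i => (b i).matE).submatrix e f)
      ((Matrix.blockDiagonal' fun i => (b i).matA).submatrix e f)) : HasKroneckerForm E A := by
  let g : Fin (Fintype.card κ) ≃ κ := (Fintype.equivFin κ).symm
  refine ⟨_, fun i => b (g i),
    e.trans (Equiv.sigmaCongrLeft (β := fun i => Fin (b i).rows) g).symm,
    f.trans (Equiv.sigmaCongrLeft (β := fun i => Fin (b i).cols) g).symm, ?_⟩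
  have hE := blockDiagonal'_reindex g fun i => (b i).matE
  have hA := blockDiagonal'_reindex g fun i => (b i).matA
  rw [hE, hA]
  simpa [submatrix_submatrix, Function.comp_def] using h

theorem HasKroneckerForm.blockDiagonal' {κ : Type*} [Fintype κ] [DecidableEq κ]
    {m n : κ → Type*} [∀ i, Fintype (m i)] [∀ i, DecidableEq (m i)]
    [∀ i, Fintype (n i)] [∀ i, DecidableEq (n i)] {E A : ∀ i, Matrix (m i) (n i) ℂ}
    (h : ∀ i, HasKroneckerForm (E i) (A i)) :
    HasKroneckerForm (Matrix.blockDiagonal' E) (Matrix.blockDiagonal' A) := by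
  choose k b e f hs using h
  refine HasKroneckerForm.of_fintype (κ := Σ i, Fin (k i)) (fun p => b p.1 p.2)
    ((Equiv.sigmaCongrRight e).trans
      (Equiv.sigmaAssoc fun i (l : Fin (k i)) => Fin (b i l).rows).symm)
    ((Equiv.sigmaCongrRight f).trans
      (Equiv.sigmaAssoc fun i (l : Fin (k i)) => Fin (b i l).cols).symm) ?_
  have key : ∀ M : ∀ c : KroneckerBlock, Matrix (Fin c.rows) (Fin c.cols) ℂ,
      (Matrix.blockDiagonal' fun p : Σ i, Fin (k i) => M (b p.1 p.2)).submatrix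
        ((Equiv.sigmaCongrRight e).trans
          (Equiv.sigmaAssoc fun i (l : Fin (k i)) => Fin (b i l).rows).symm)
        ((Equiv.sigmaCongrRight f).trans
          (Equiv.sigmaAssoc fun i (l : Fin (k i)) => Fin (b i l).cols).symm) =
      Matrix.blockDiagonal' fun i =>
        (Matrix.blockDiagonal' fun l => M (b i l)).submatrix (e i) (f i) := by
    intro M
    ext ⟨i, r⟩ ⟨j, c⟩
    by_cases hij : i = j
    · subst hij
      rw [blockDiagonal'_apply_eq, submatrix_apply, submatrix_apply]
      simp only [Equiv.trans_apply, Equiv.sigmaCongrRight_apply]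
      obtain ⟨l, x⟩ := e i r
      obtain ⟨l', y⟩ := f i c
      by_cases hl : l = l'
      · subst hl
        rw [blockDiagonal'_apply_eq]
        exact blockDiagonal'_apply_eq (fun p : Σ i, Fin (k i) => M (b p.1 p.2)) ⟨i, l⟩ x y
      · rw [blockDiagonal'_apply_ne _ _ _ hl]
        refine blockDiagonal'_apply_ne (fun p : Σ i, Fin (k i) => M (b p.1 p.2)) (k := ⟨i, l⟩)
          (k' := ⟨i, l'⟩) x y ?_
        simpa using hl
    · rw [blockDiagonal'_apply_ne _ _ _ hij, submatrix_apply]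
      refine blockDiagonal'_apply_ne _ _ _ fun h => hij ?_
      exact congrArg Sigma.fst h
  rw [key KroneckerBlock.matE, key KroneckerBlock.matA]
  exact StronglyEquivalent.blockDiagonal' hs

theorem HasKroneckerForm.single (c : KroneckerBlock) : HasKroneckerForm c.matE c.matA := by
  refine HasKroneckerForm.of_fintype (κ := Unit) (fun _ => c)
    (Equiv.uniqueSigma fun _ : Unit => Fin c.rows).symm
    (Equiv.uniqueSigma fun _ : Unit => Fin c.cols).symm ?_
  refine .of_mul_eq 1 1 isUnit_one isUnit_one ?_ ?_ <;> rw [Matrix.one_mul, Matrix.mul_one]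
  · ext i j
    exact (blockDiagonal'_apply_eq (fun _ : Unit => c.matE) () i j).symm
  · ext i j
    exact (blockDiagonal'_apply_eq (fun _ : Unit => c.matA) () i j).symm

/-- The zero pencil of size `n` consists of `n` blocks `L₀` (of size `0 × 1`) and `n` blocks `L₀ᵀ`
(of size `1 × 0`). -/
theorem HasKroneckerForm.zero (n : ℕ) :
    HasKroneckerForm (0 : Matrix (Fin n) (Fin n) ℂ) 0 := by
  let b : Fin n ⊕ Fin n → KroneckerBlock :=
    Sum.elim (fun _ => .singL 0) (fun _ => .singLT 0)
  let e : Fin n ≃ Σ i, Fin (b i).rows :=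
    Fintype.equivOfCardEq (by
      rw [Fintype.card_sigma, Fintype.sum_sum_type]; simp [b, KroneckerBlock.rows]
      exact fun _ => Fintype.card_fin 0)
  let f : Fin n ≃ Σ i, Fin (b i).cols :=
    Fintype.equivOfCardEq (by
      rw [Fintype.card_sigma, Fintype.sum_sum_type]; simp [b, KroneckerBlock.cols]
      exact fun _ => Fintype.card_fin 0)
  have key : ∀ M : ∀ i, Matrix (Fin (b i).rows) (Fin (b i).cols) ℂ,
      (Matrix.blockDiagonal' M).submatrix e f = 0 := by
    intro M
    ext r c
    rw [submatrix_apply]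
    rcases e r with ⟨i | i, x⟩
    · exact Fin.elim0 x
    · rcases f c with ⟨j | j, y⟩
      · exact blockDiagonal'_apply_ne _ _ _ (by simp)
      · exact Fin.elim0 y
  refine HasKroneckerForm.of_fintype b e f ?_
  rw [key, key]
  exact .of_mul_eq 1 1 isUnit_one isUnit_one (by simp) (by simp)

theorem hasKroneckerForm_zero : HasKroneckerForm (0 : Matrix n n ℂ) 0 :=
  (HasKroneckerForm.zero (Fintype.card n)).submatrix (Fintype.equivFin n) (Fintype.equivFin n)

end Pencil

/-! ### Kronecker canonical form of regular pencils -/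

theorem hasKroneckerForm_of_isEmpty {n : Type*} [Fintype n] [DecidableEq n] [IsEmpty n]
    (E A : Matrix n n ℂ) : HasKroneckerForm E A := by
  rw [Subsingleton.elim E 0, Subsingleton.elim A 0]
  exact hasKroneckerForm_zero

theorem hasKroneckerForm_one_jordanBlock (n : ℕ) (μ : ℂ) :
    HasKroneckerForm 1 (jordanBlock n μ) := by
  rcases Nat.eq_zero_or_pos n with rfl | hn
  · exact hasKroneckerForm_of_isEmpty _ _
  · have h := HasKroneckerForm.single (.jordan ⟨n, hn⟩ μ)
    have hE : (KroneckerBlock.jordan ⟨n, hn⟩ μ).matE = (1 : Matrix (Fin n) (Fin n) ℂ) := by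
      refine Matrix.ext fun (i : Fin n) (j : Fin n) => ?_
      exact ((Matrix.one_apply (i := i) (j := j)).trans (if_congr Fin.ext_iff rfl rfl)).symm
    rw [hE] at h
    exact h

theorem hasKroneckerForm_jordanBlock_zero_one (n : ℕ) :
    HasKroneckerForm (jordanBlock n 0) 1 := by
  rcases Nat.eq_zero_or_pos n with rfl | hn
  · exact hasKroneckerForm_of_isEmpty _ _
  · have h := HasKroneckerForm.single (.nilp ⟨n, hn⟩)
    have hE : (KroneckerBlock.nilp ⟨n, hn⟩).matE = jordanBlock n 0 := by
      ext i j
      change (if (j : ℕ) = i + 1 then (1 : ℂ) else 0) =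
        if (i : ℕ) = j then 0 else if (j : ℕ) = i + 1 then 1 else 0
      by_cases hij : (i : ℕ) = j
      · simp [hij]
      · simp [hij]
    have hA : (KroneckerBlock.nilp ⟨n, hn⟩).matA = (1 : Matrix (Fin n) (Fin n) ℂ) := by
      refine Matrix.ext fun (i : Fin n) (j : Fin n) => ?_
      exact ((Matrix.one_apply (i := i) (j := j)).trans (if_congr Fin.ext_iff rfl rfl)).symm
    rw [hE, hA] at h
    exact h

theorem jordanBlock_charpoly (n : ℕ) (μ : ℂ) :
    (jordanBlock n μ).charpoly = (Polynomial.X - Polynomial.C μ) ^ n := by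
  have h : (jordanBlock n μ).BlockTriangular id := by
    intro i j hij
    have hij' : (j : ℕ) < i := hij
    simp only [jordanBlock, of_apply]
    rw [if_neg (by omega), if_neg (by omega)]
  rw [charpoly_of_isUpperTriangular _ h]
  simp [jordanBlock]

theorem isUnit_jordanBlock {n : ℕ} {μ : ℂ} (hμ : μ ≠ 0) : IsUnit (jordanBlock n μ) := by
  rw [Matrix.isUnit_iff_isUnit_det, Matrix.det_eq_sign_charpoly_coeff, jordanBlock_charpoly,
    Polynomial.coeff_zero_eq_eval_zero]
  simp [hμ]

theorem isNilpotent_jordanBlock_zero (n : ℕ) : IsNilpotent (jordanBlock n 0) := by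
  refine ⟨n, ?_⟩
  have h := Matrix.aeval_self_charpoly (jordanBlock n 0)
  simpa [jordanBlock_charpoly] using h

section

variable {n : Type*} [Fintype n] [DecidableEq n]

theorem hasKroneckerForm_one_left (C : Matrix n n ℂ) : HasKroneckerForm 1 C := by
  obtain ⟨κ, _, _, ρ, μ, e, P, hP, hC⟩ := exists_jordan_form C
  obtain ⟨u, rfl⟩ := hP
  have hb := (HasKroneckerForm.blockDiagonal' (E := fun i => (1 : Matrix (Fin (ρ i)) _ ℂ))
    fun i => hasKroneckerForm_one_jordanBlock (ρ i) (μ i)).submatrix e e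
  refine hb.of_stronglyEquivalent
    (.of_mul_eq (↑u⁻¹ : Matrix n n ℂ) u (Units.isUnit _) (Units.isUnit _) ?_ ?_)
  · rw [Matrix.mul_one, ← Pi.one_def, blockDiagonal'_one, submatrix_one_equiv]
    exact u.inv_mul
  · rw [Matrix.mul_assoc, hC, ← Matrix.mul_assoc]
    exact (congrArg (· * _) u.inv_mul).trans (Matrix.one_mul _)

/-- The pencil `λ N - 1` with `N` nilpotent: all Jordan blocks of `N` have eigenvalue `0`, and so
are the nilpotent blocks of the Kronecker canonical form. -/
theorem hasKroneckerForm_one_right {N : Matrix n n ℂ} (hN : IsNilpotent N) :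
    HasKroneckerForm N 1 := by
  obtain ⟨κ, _, _, ρ, μ, e, P, hP, hC⟩ := exists_jordan_form N
  obtain ⟨u, rfl⟩ := hP
  have hD : (blockDiagonal' fun i => jordanBlock (ρ i) (μ i)).submatrix e e =
      (↑u⁻¹ : Matrix n n ℂ) * N * u := by
    rw [Matrix.mul_assoc, hC, ← Matrix.mul_assoc]
    exact ((congrArg (· * _) u.inv_mul).trans (Matrix.one_mul _)).symm
  have hblock : ∀ i, HasKroneckerForm (jordanBlock (ρ i) (μ i)) 1 := by
    intro i
    rcases Nat.eq_zero_or_pos (ρ i) with h0 | hpos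
    · have : IsEmpty (Fin (ρ i)) := by rw [h0]; infer_instance
      exact hasKroneckerForm_of_isEmpty _ _
    · obtain ⟨k, hk⟩ : IsNilpotent (blockDiagonal' fun i => jordanBlock (ρ i) (μ i)) := by
        obtain ⟨k, hk⟩ := hN
        have hconj : IsNilpotent
            ((blockDiagonal' fun i => jordanBlock (ρ i) (μ i)).submatrix e e) := by
          refine ⟨k, ?_⟩
          rw [hD]
          refine (Units.conj_pow' u N k).trans ?_
          rw [hk, mul_zero, zero_mul]
        have := hconj.map (reindexAlgEquiv ℂ ℂ e)
        simpa using this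
      rw [← blockDiagonal'_pow, ← blockDiagonal'_zero] at hk
      have hik : jordanBlock (ρ i) (μ i) ^ k = 0 := congrFun (blockDiagonal'_injective hk) i
      have hμ : μ i = 0 := by
        by_contra hμ
        have := (isUnit_jordanBlock (n := ρ i) hμ).pow k
        rw [hik, isUnit_zero_iff] at this
        have h := congrFun (congrFun this ⟨0, hpos⟩) ⟨0, hpos⟩
        simp at h
      rw [hμ]
      exact hasKroneckerForm_jordanBlock_zero_one _
  have hb := (HasKroneckerForm.blockDiagonal' (A := fun i => (1 : Matrix (Fin (ρ i)) _ ℂ))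
    hblock).submatrix e e
  refine hb.of_stronglyEquivalent
    (.of_mul_eq (↑u⁻¹ : Matrix n n ℂ) u (Units.isUnit _) (Units.isUnit _) hD.symm ?_)
  · rw [Matrix.mul_one, ← Pi.one_def, blockDiagonal'_one, submatrix_one_equiv]
    exact u.inv_mul

/-- The pencil `λ M - (M - 1)`, for one Jordan block `M`. If the eigenvalue is nonzero, `M` can be
normalized to the identity; otherwise `M - 1` can. -/
theorem hasKroneckerForm_jordanBlock_sub_one (n : ℕ) (μ : ℂ) :
    HasKroneckerForm (jordanBlock n μ) (jordanBlock n μ - 1) := by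
  by_cases hμ : μ = 0
  · subst hμ
    have hnil := isNilpotent_jordanBlock_zero n
    set N := jordanBlock n 0
    obtain ⟨u, hu⟩ : IsUnit (N - 1) := hnil.isUnit_sub_one
    have hcomm : Commute (↑u⁻¹ : Matrix (Fin n) (Fin n) ℂ) N := by
      apply Commute.units_inv_left
      rw [hu]
      exact (Commute.refl N).sub_left (Commute.one_left N)
    refine (hasKroneckerForm_one_right (hcomm.isNilpotent_mul_left hnil)).of_stronglyEquivalent
      (.of_mul_eq (↑u⁻¹ : Matrix (Fin n) (Fin n) ℂ) 1 (Units.isUnit _) isUnit_one ?_ ?_)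
    · rw [Matrix.mul_one]
    · rw [Matrix.mul_one, ← hu]
      exact u.inv_mul
  · obtain ⟨u, hu⟩ := isUnit_jordanBlock (n := n) hμ
    rw [← hu]
    exact (hasKroneckerForm_one_left _).of_stronglyEquivalent
      (.of_mul_eq (↑u⁻¹ : Matrix (Fin n) (Fin n) ℂ) 1 (Units.isUnit _) isUnit_one
        ((Matrix.mul_one _).trans u.inv_mul) rfl)

/-- Weierstrass: if `E - A` is invertible, the pencil `λ E - A` has a Kronecker canonical form.
With `M = (E - A)⁻¹ E` the pencil is strongly equivalent to `λ M - (M - 1)`, and the Jordan form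
of `M` decouples it. -/
theorem hasKroneckerForm_of_isUnit_sub {E A : Matrix n n ℂ} (h : IsUnit (E - A)) :
    HasKroneckerForm E A := by
  obtain ⟨v, hv⟩ := h
  obtain ⟨κ, _, _, ρ, μ, e, P, hP, hM⟩ := exists_jordan_form ((↑v⁻¹ : Matrix n n ℂ) * E)
  obtain ⟨u, rfl⟩ := hP
  have hb := (HasKroneckerForm.blockDiagonal'
    fun i => hasKroneckerForm_jordanBlock_sub_one (ρ i) (μ i)).submatrix e e
  have hD : (↑u⁻¹ : Matrix n n ℂ) * (↑v⁻¹ : Matrix n n ℂ) * E * u =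
      (blockDiagonal' fun i => jordanBlock (ρ i) (μ i)).submatrix e e := by
    rw [Matrix.mul_assoc _ _ E, Matrix.mul_assoc, hM, ← Matrix.mul_assoc]
    exact (congrArg (· * _) u.inv_mul).trans (Matrix.one_mul _)
  refine hb.of_stronglyEquivalent
    (.of_mul_eq ((↑u⁻¹ : Matrix n n ℂ) * (↑v⁻¹ : Matrix n n ℂ)) u
      ((Units.isUnit _).mul (Units.isUnit _)) (Units.isUnit _) hD ?_)
  have hA : A = E - v := by rw [hv, sub_sub_cancel]
  have hsub : (blockDiagonal' fun i => jordanBlock (ρ i) (μ i) - 1) =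
      (blockDiagonal' fun i => jordanBlock (ρ i) (μ i)) - 1 := by
    rw [← blockDiagonal'_one, ← blockDiagonal'_sub]
    rfl
  rw [hsub, submatrix_sub, Pi.sub_apply, Pi.sub_apply, submatrix_one_equiv, ← hD]
  nth_rw 1 [hA]
  rw [Matrix.mul_sub, Matrix.sub_mul, Matrix.mul_assoc (↑u⁻¹ : Matrix n n ℂ)]
  congr 1
  have h1 : (↑v⁻¹ : Matrix n n ℂ) * v = 1 := v.inv_mul
  rw [Matrix.mul_assoc (↑u⁻¹ : Matrix n n ℂ), h1, Matrix.mul_one]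
  exact u.inv_mul

/-- A pencil that splits along a colouring `g` of its indices has a Kronecker canonical form as
soon as each of its diagonal blocks has one. -/
theorem hasKroneckerForm_of_fibers {κ : Type*} [Fintype κ] [DecidableEq κ] (g : n → κ)
    {E A : Matrix n n ℂ} (hE : ∀ i j, g i ≠ g j → E i j = 0)
    (hA : ∀ i j, g i ≠ g j → A i j = 0)
    (h : ∀ k, HasKroneckerForm (m := {i // g i = k}) (n := {i // g i = k})
      (E.submatrix Subtype.val Subtype.val)
      (A.submatrix Subtype.val Subtype.val)) :
    HasKroneckerForm E A := by
  have hb := (HasKroneckerForm.blockDiagonal' (m := fun k => {i // g i = k})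
    (n := fun k => {i // g i = k}) h).submatrix (Equiv.sigmaFiberEquiv g).symm
    (Equiv.sigmaFiberEquiv g).symm
  have key : ∀ M : Matrix n n ℂ, (∀ i j, g i ≠ g j → M i j = 0) →
      (blockDiagonal' fun k => M.submatrix (Subtype.val : {i // g i = k} → n)
        (Subtype.val : {i // g i = k} → n)).submatrix
        (Equiv.sigmaFiberEquiv g).symm (Equiv.sigmaFiberEquiv g).symm = M := by
    intro M hM
    have hM' : ∀ s t : Σ k, {i // g i = k}, (blockDiagonal' fun k =>
        M.submatrix (Subtype.val : {i // g i = k} → n) (Subtype.val : {i // g i = k} → n)) s t =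
        M s.2 t.2 := by
      rintro ⟨k, i, rfl⟩ ⟨l, j, hj⟩
      by_cases hij : g i = l
      · subst hij
        exact blockDiagonal'_apply_eq _ _ _ _
      · rw [blockDiagonal'_apply_ne _ _ _ hij]
        exact (hM _ _ (hj ▸ hij)).symm
    ext i j
    exact hM' _ _
  rwa [key E hE, key A hA] at hb

end

/-! ### Chains at infinity in Kronecker blocks -/

namespace KroneckerBlock

theorem nilp_matE_mulVec_single {σ : ℕ+} (k r : Fin σ) :
    ((nilp σ).matE *ᵥ (Pi.single k 1 : Fin σ → ℂ)) r = if (k : ℕ) = r + 1 then 1 else 0 := by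
  have h := mulVec_single_one ((nilp σ).matE : Matrix (Fin σ) (Fin σ) ℂ) k
  exact congrFun h r

theorem nilp_matA_mulVec_single {σ : ℕ+} (k r : Fin σ) :
    ((nilp σ).matA *ᵥ (Pi.single k 1 : Fin σ → ℂ)) r = if (r : ℕ) = k then 1 else 0 := by
  have h := mulVec_single_one ((nilp σ).matA : Matrix (Fin σ) (Fin σ) ℂ) k
  exact congrFun h r

theorem nilp_matE_mulVec_single_zero {σ : ℕ+} :
    (nilp σ).matE *ᵥ (Pi.single ⟨0, σ.pos⟩ 1 : Fin σ → ℂ) = 0 := by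
  funext (r : Fin σ)
  exact (nilp_matE_mulVec_single _ r).trans (if_neg (Nat.succ_ne_zero _).symm)

theorem nilp_matA_mulVec_single_eq {σ : ℕ+} (k : ℕ) (hk : k + 1 < σ) :
    (nilp σ).matA *ᵥ (Pi.single ⟨k, by omega⟩ 1 : Fin σ → ℂ) =
      (nilp σ).matE *ᵥ (Pi.single ⟨k + 1, hk⟩ 1 : Fin σ → ℂ) := by
  funext (r : Fin σ)
  refine (nilp_matA_mulVec_single _ r).trans (Eq.trans ?_ (nilp_matE_mulVec_single _ r).symm)
  exact if_congr (by simp [eq_comm]) rfl rfl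

theorem nilp_matA_mulVec_single_ne_zero {σ : ℕ+} (k : Fin σ) :
    (nilp σ).matA *ᵥ (Pi.single k 1 : Fin σ → ℂ) ≠ 0 := by
  intro h
  exact one_ne_zero ((if_pos rfl).symm.trans
    ((nilp_matA_mulVec_single k k).symm.trans (congrFun h k)))

theorem exists_chain_one (c : KroneckerBlock) (h : 1 ≤ c.nilpSize) :
    ∃ x, c.matE *ᵥ x = 0 ∧ c.matA *ᵥ x ≠ 0 := by
  cases c with
  | nilp σ => exact ⟨_, nilp_matE_mulVec_single_zero, nilp_matA_mulVec_single_ne_zero _⟩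
  | _ => simp [nilpSize] at h

theorem exists_chain_two (c : KroneckerBlock) (h : 2 ≤ c.nilpSize) :
    ∃ x y, c.matE *ᵥ x = 0 ∧ c.matA *ᵥ x = c.matE *ᵥ y ∧ c.matA *ᵥ x ≠ 0 := by
  cases c with
  | nilp σ =>
    exact ⟨_, _, nilp_matE_mulVec_single_zero, nilp_matA_mulVec_single_eq 0 h,
      nilp_matA_mulVec_single_ne_zero _⟩
  | _ => simp [nilpSize] at h

theorem exists_chain_three (c : KroneckerBlock) (h : 3 ≤ c.nilpSize) :
    ∃ x y z, c.matE *ᵥ x = 0 ∧ c.matA *ᵥ x = c.matE *ᵥ y ∧ c.matA *ᵥ y = c.matE *ᵥ z ∧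
      c.matA *ᵥ x ≠ 0 := by
  cases c with
  | nilp σ =>
    have h' : 3 ≤ (σ : ℕ) := h
    exact ⟨_, _, _, nilp_matE_mulVec_single_zero, nilp_matA_mulVec_single_eq 0 (by omega),
      nilp_matA_mulVec_single_eq 1 h', nilp_matA_mulVec_single_ne_zero _⟩
  | _ => simp [nilpSize] at h

/-- A block `L_ε` with `ε > 0` has a null vector `x` of `E - A` (the all-ones vector) with
`E x ≠ 0`. -/
theorem singL_exists_mulVec_eq {ε : ℕ} (hε : 0 < ε) :
    ∃ x, (singL ε).matE *ᵥ x = (singL ε).matA *ᵥ x ∧ (singL ε).matE *ᵥ x ≠ 0 := by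
  have hE : (singL ε).matE *ᵥ (fun _ => 1) = fun _ => 1 := by
    funext (r : Fin ε)
    change ∑ j : Fin (ε + 1), (if (j : ℕ) = r then (1 : ℂ) else 0) * 1 = 1
    rw [Finset.sum_eq_single r.castSucc]
    · simp
    · intro j _ hj
      rw [if_neg (fun h => hj (Fin.ext (by simpa using h))), zero_mul]
    · simp
  have hA : (singL ε).matA *ᵥ (fun _ => 1) = fun _ => 1 := by
    funext (r : Fin ε)
    change ∑ j : Fin (ε + 1), (if (j : ℕ) = r + 1 then (1 : ℂ) else 0) * 1 = 1
    rw [Finset.sum_eq_single r.succ]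
    · simp
    · intro j _ hj
      rw [if_neg (fun h => hj (Fin.ext (by simpa using h))), zero_mul]
    · simp
  refine ⟨fun _ => 1, hE.trans hA.symm, fun h => ?_⟩
  rw [hE] at h
  exact one_ne_zero (congrFun h (⟨0, hε⟩ : Fin ε))

theorem singLT_eq_zero_of_mulVec_eq_zero {η : ℕ} {x : Fin (singLT η).cols → ℂ}
    (h : (singLT η).matE *ᵥ x = 0) : x = 0 := by
  funext (c : Fin η)
  have hc : ∑ j : Fin η, (if (c : ℕ) = j then (1 : ℂ) else 0) * x j = 0 :=
    congrFun h (c.castSucc : Fin (η + 1))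
  rwa [Finset.sum_eq_single c, if_pos rfl, one_mul] at hc
  · intro j _ hj
    rw [if_neg (fun h => hj (Fin.ext h.symm)), zero_mul]
  · simp

theorem jordan_eq_zero_of_mulVec_eq_zero {ρ : ℕ+} {μ : ℂ} {x : Fin (jordan ρ μ).cols → ℂ}
    (h : (jordan ρ μ).matE *ᵥ x = 0) : x = 0 := by
  funext (c : Fin ρ)
  have hc : ∑ j : Fin ρ, (if (c : ℕ) = j then (1 : ℂ) else 0) * x j = 0 :=
    congrFun h (c : Fin ρ)
  rwa [Finset.sum_eq_single c, if_pos rfl, one_mul] at hc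
  · intro j _ hj
    rw [if_neg (fun h => hj (Fin.ext h.symm)), zero_mul]
  · simp

theorem nilp_matE_eq_zero {σ : ℕ+} (h : (σ : ℕ) ≤ 1) : (nilp σ).matE = 0 := by
  refine Matrix.ext fun (i : Fin σ) (j : Fin σ) => ?_
  have hi : (i : ℕ) < σ := i.2
  have hj : (j : ℕ) < σ := j.2
  exact if_neg (by omega)

/-- Among the blocks of nilpotent size at most `1`, only the blocks `L_ε` with `ε > 0` admit a
chain `E x = 0`, `A x = E y` with `A x ≠ 0`. -/
theorem matA_mulVec_eq_zero_of_chain (c : KroneckerBlock) (h1 : c.nilpSize ≤ 1)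
    (hL : ∀ x, c.matE *ᵥ x = c.matA *ᵥ x → c.matE *ᵥ x = 0) {x y}
    (hx : c.matE *ᵥ x = 0) (hy : c.matA *ᵥ x = c.matE *ᵥ y) : c.matA *ᵥ x = 0 := by
  cases c with
  | singL ε =>
    rcases Nat.eq_zero_or_pos ε with rfl | hε
    · funext r
      exact Fin.elim0 r
    · obtain ⟨z, hz, hz0⟩ := singL_exists_mulVec_eq hε
      exact absurd (hL z hz) hz0
  | singLT η => rw [singLT_eq_zero_of_mulVec_eq_zero hx, mulVec_zero]
  | jordan ρ μ => rw [jordan_eq_zero_of_mulVec_eq_zero hx, mulVec_zero]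
  | nilp σ => rw [hy, nilp_matE_eq_zero h1, zero_mulVec]

theorem matA_mulVec_eq_zero_of_matE (c : KroneckerBlock) (h0 : c.nilpSize = 0)
    (hL : ∀ x, c.matE *ᵥ x = c.matA *ᵥ x → c.matE *ᵥ x = 0) {x}
    (hx : c.matE *ᵥ x = 0) : c.matA *ᵥ x = 0 := by
  cases c with
  | singL ε =>
    rcases Nat.eq_zero_or_pos ε with rfl | hε
    · funext r
      exact Fin.elim0 r
    · obtain ⟨z, hz, hz0⟩ := singL_exists_mulVec_eq hε
      exact absurd (hL z hz) hz0
  | singLT η => rw [singLT_eq_zero_of_mulVec_eq_zero hx, mulVec_zero]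
  | jordan ρ μ => rw [jordan_eq_zero_of_mulVec_eq_zero hx, mulVec_zero]
  | nilp σ => exact absurd h0 σ.pos.ne'

end KroneckerBlock

/-! ### Chains at infinity and the sizes of the nilpotent blocks -/

section Index

variable {m n : Type*} [Fintype m] [DecidableEq m] [Fintype n] [DecidableEq n]

theorem exists_linearEquiv_sigma {κ : Type*} {γ : κ → Type*} (u : (Matrix m m ℂ)ˣ)
    (e : m ≃ Σ i, γ i) : ∃ φ : (m → ℂ) ≃ₗ[ℂ] ((i : κ) → γ i → ℂ),
      ∀ y i r, φ y i r = ((u : Matrix m m ℂ) *ᵥ y) (e.symm ⟨i, r⟩) := by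
  have h1 : (u : Matrix m m ℂ) * (↑u⁻¹ : Matrix m m ℂ) = 1 := u.mul_inv
  have h2 : (↑u⁻¹ : Matrix m m ℂ) * (u : Matrix m m ℂ) = 1 := u.inv_mul
  refine ⟨{ toFun := fun y i r => ((u : Matrix m m ℂ) *ᵥ y) (e.symm ⟨i, r⟩)
            map_add' := fun x y => by rw [mulVec_add]; rfl
            map_smul' := fun c x => by rw [mulVec_smul]; rfl
            invFun := fun z => (↑u⁻¹ : Matrix m m ℂ) *ᵥ fun j => z (e j).1 (e j).2
            left_inv := fun x => ?_
            right_inv := fun z => ?_ }, fun _ _ _ => rfl⟩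
  · simp only [Sigma.eta, Equiv.symm_apply_apply]
    rw [mulVec_mulVec, h2, one_mulVec]
  · funext i r
    beta_reduce
    rw [mulVec_mulVec, h1, one_mulVec, Equiv.apply_symm_apply]

/-- A Kronecker canonical form as a simultaneous change of coordinates in the domain and the
codomain of `E` and `A`. -/
theorem IsKroneckerForm.exists_linearEquiv {E A : Matrix m n ℂ} {k : ℕ}
    {b : Fin k → KroneckerBlock} (h : IsKroneckerForm E A b) :
    ∃ (φ : (n → ℂ) ≃ₗ[ℂ] ((i : Fin k) → Fin (b i).cols → ℂ))
      (ψ : (m → ℂ) ≃ₗ[ℂ] ((i : Fin k) → Fin (b i).rows → ℂ)),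
      (∀ x i, ψ (E *ᵥ x) i = (b i).matE *ᵥ φ x i) ∧
      ∀ x i, ψ (A *ᵥ x) i = (b i).matA *ᵥ φ x i := by
  obtain ⟨e, f, h⟩ := h
  obtain ⟨S, T, ⟨u, rfl⟩, ⟨v, rfl⟩, hE, hA⟩ := h.exists_mul_eq
  obtain ⟨φ, hφ⟩ := exists_linearEquiv_sigma v⁻¹ f
  obtain ⟨ψ, hψ⟩ := exists_linearEquiv_sigma u e
  have key : ∀ (M : Matrix m n ℂ) (N : ∀ i, Matrix (Fin (b i).rows) (Fin (b i).cols) ℂ),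
      (u : Matrix m m ℂ) * M * (v : Matrix n n ℂ) = (blockDiagonal' N).submatrix e f →
      ∀ x i, ψ (M *ᵥ x) i = N i *ᵥ φ x i := by
    intro M N hM x i
    funext r
    have hv : (v : Matrix n n ℂ) * (↑v⁻¹ : Matrix n n ℂ) = 1 := v.mul_inv
    have hx : (u : Matrix m m ℂ) *ᵥ (M *ᵥ x) =
        ((blockDiagonal' N).submatrix e f) *ᵥ ((↑v⁻¹ : Matrix n n ℂ) *ᵥ x) := by
      rw [← hM, mulVec_mulVec, mulVec_mulVec, Matrix.mul_assoc _ _ (↑v⁻¹ : Matrix n n ℂ), hv,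
        Matrix.mul_one]
    rw [hψ, hx]
    simp only [mulVec, dotProduct, submatrix_apply, Equiv.apply_symm_apply] at hφ ⊢
    simp only [hφ]
    rw [← f.symm.sum_comp, Fintype.sum_sigma, Finset.sum_eq_single i]
    · simp only [Equiv.apply_symm_apply, blockDiagonal'_apply_eq]
    · intro j _ hj
      refine Finset.sum_eq_zero fun c _ => ?_
      rw [Equiv.apply_symm_apply, blockDiagonal'_apply_ne _ _ _ hj.symm, zero_mul]
    · simp
  exact ⟨φ, ψ, key E _ hE, key A _ hA⟩

/-- Vectors of a block of the Kronecker canonical form extend to vectors of the whole pencil,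
compatibly with `E` and `A`. -/
theorem IsKroneckerForm.exists_block_embedding {E A : Matrix m n ℂ} {k : ℕ}
    {b : Fin k → KroneckerBlock} (h : IsKroneckerForm E A b) (i : Fin k) :
    ∃ (f : (Fin (b i).cols → ℂ) → n → ℂ) (g : (Fin (b i).rows → ℂ) → m → ℂ),
      g 0 = 0 ∧ (∀ y, g y = 0 → y = 0) ∧
      (∀ x, E *ᵥ f x = g ((b i).matE *ᵥ x)) ∧ ∀ x, A *ᵥ f x = g ((b i).matA *ᵥ x) := by
  obtain ⟨φ, ψ, hE, hA⟩ := h.exists_linearEquiv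
  have key : ∀ (M : Matrix m n ℂ) (N : ∀ i, Matrix (Fin (b i).rows) (Fin (b i).cols) ℂ),
      (∀ x i, ψ (M *ᵥ x) i = N i *ᵥ φ x i) →
      ∀ x, M *ᵥ φ.symm (Pi.single i x) = ψ.symm (Pi.single i (N i *ᵥ x)) := by
    intro M N hM x
    apply ψ.injective
    funext j
    rw [hM, LinearEquiv.apply_symm_apply, LinearEquiv.apply_symm_apply]
    by_cases hj : j = i
    · subst hj
      rw [Pi.single_eq_same, Pi.single_eq_same]
    · rw [Pi.single_eq_of_ne hj, Pi.single_eq_of_ne hj, mulVec_zero]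
  refine ⟨fun x => φ.symm (Pi.single i x), fun y => ψ.symm (Pi.single i y),
    by beta_reduce; rw [Pi.single_zero, map_zero], ?_,
    key E (fun i => (b i).matE) hE, key A (fun i => (b i).matA) hA⟩
  intro y hy
  exact Pi.single_eq_zero_iff.1 (ψ.symm.map_eq_zero_iff.1 hy)

variable {E A : Matrix m n ℂ} {k : ℕ} {b : Fin k → KroneckerBlock}

/-- This lemma and the next two bound the nilpotent blocks. A nilpotent block of size `s` contains a
chain `E x₁ = 0`, `A x₁ = E x₂`, …, `A x_{s-1} = E x_s` with `A x₁ ≠ 0`. -/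
theorem IsKroneckerForm.nilpSize_eq_zero (h : IsKroneckerForm E A b)
    (h1 : ∀ x, E *ᵥ x = 0 → A *ᵥ x = 0) (i : Fin k) : (b i).nilpSize = 0 := by
  by_contra hi
  obtain ⟨f, g, g0, ginj, hE, hA⟩ := h.exists_block_embedding i
  obtain ⟨x, hx, hx'⟩ := (b i).exists_chain_one (Nat.one_le_iff_ne_zero.2 hi)
  exact hx' (ginj _ ((hA x).symm.trans (h1 _ (by rw [hE, hx, g0]))))

theorem IsKroneckerForm.nilpSize_le_one (h : IsKroneckerForm E A b)
    (h2 : ∀ x y, E *ᵥ x = 0 → A *ᵥ x = E *ᵥ y → A *ᵥ x = 0) (i : Fin k) :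
    (b i).nilpSize ≤ 1 := by
  by_contra! hi
  obtain ⟨f, g, g0, ginj, hE, hA⟩ := h.exists_block_embedding i
  obtain ⟨x, y, hx, hy, hx'⟩ := (b i).exists_chain_two hi
  exact hx' (ginj _ ((hA x).symm.trans (h2 _ (f y) (by rw [hE, hx, g0]) (by rw [hA, hE, hy]))))

theorem IsKroneckerForm.nilpSize_le_two (h : IsKroneckerForm E A b)
    (h3 : ∀ x y z, E *ᵥ x = 0 → A *ᵥ x = E *ᵥ y → A *ᵥ y = E *ᵥ z → A *ᵥ x = 0) (i : Fin k) :
    (b i).nilpSize ≤ 2 := by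
  by_contra! hi
  obtain ⟨f, g, g0, ginj, hE, hA⟩ := h.exists_block_embedding i
  obtain ⟨x, y, z, hx, hy, hz, hx'⟩ := (b i).exists_chain_three hi
  exact hx' (ginj _ ((hA x).symm.trans
    (h3 _ (f y) (f z) (by rw [hE, hx, g0]) (by rw [hA, hE, hy]) (by rw [hA, hE, hz]))))

/-- If `ker (E - A) ⊆ ker E`, the same holds for every block; this excludes the blocks `L_ε`
with `ε > 0`. -/
theorem IsKroneckerForm.block_ker_sub (h : IsKroneckerForm E A b)
    (h0 : ∀ x, E *ᵥ x = A *ᵥ x → E *ᵥ x = 0) (i : Fin k) (x) :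
    (b i).matE *ᵥ x = (b i).matA *ᵥ x → (b i).matE *ᵥ x = 0 := by
  intro hx
  obtain ⟨f, g, g0, ginj, hE, hA⟩ := h.exists_block_embedding i
  exact ginj _ ((hE x).symm.trans (h0 _ (by rw [hE, hA, hx])))

/-- Conversely, chains at infinity force nilpotent blocks. The blocks `L_ε` with `ε > 0` also
contain such chains, which is why `ker (E - A) ⊆ ker E` is needed here. -/
theorem IsKroneckerForm.exists_one_le_nilpSize (h : IsKroneckerForm E A b)
    (h0 : ∀ x, E *ᵥ x = A *ᵥ x → E *ᵥ x = 0) {x : n → ℂ} (hx : E *ᵥ x = 0)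
    (hx' : A *ᵥ x ≠ 0) : ∃ i, 1 ≤ (b i).nilpSize := by
  by_contra! hb
  obtain ⟨φ, ψ, hE, hA⟩ := h.exists_linearEquiv
  refine hx' (ψ.map_eq_zero_iff.1 (funext fun i => ?_))
  rw [hA]
  refine (b i).matA_mulVec_eq_zero_of_matE (Nat.lt_one_iff.1 (hb i)) (h.block_ker_sub h0 i) ?_
  rw [← hE, hx, map_zero]
  rfl

theorem IsKroneckerForm.exists_two_le_nilpSize (h : IsKroneckerForm E A b)
    (h0 : ∀ x, E *ᵥ x = A *ᵥ x → E *ᵥ x = 0) {x y : n → ℂ} (hx : E *ᵥ x = 0)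
    (hy : A *ᵥ x = E *ᵥ y) (hx' : A *ᵥ x ≠ 0) : ∃ i, 2 ≤ (b i).nilpSize := by
  by_contra! hb
  obtain ⟨φ, ψ, hE, hA⟩ := h.exists_linearEquiv
  refine hx' (ψ.map_eq_zero_iff.1 (funext fun i => ?_))
  rw [hA]
  refine (b i).matA_mulVec_eq_zero_of_chain (Nat.lt_succ_iff.1 (hb i)) (h.block_ker_sub h0 i)
    (y := φ y i) ?_ ?_
  · rw [← hE, hx, map_zero]
    rfl
  · rw [← hE, ← hA, hy]

end Index

/-! ### Complexification of real matrices -/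

section Complexify

variable {m n : Type*} [Fintype n]

theorem map_ofReal_mulVec_ofReal (M : Matrix m n ℝ) (v : n → ℝ) :
    M.map Complex.ofReal *ᵥ (fun i => (v i : ℂ)) = fun i => ((M *ᵥ v) i : ℂ) := by
  funext i
  simp [mulVec, dotProduct]

theorem map_ofReal_mulVec_re (M : Matrix m n ℝ) (x : n → ℂ) (i : m) :
    ((M.map Complex.ofReal *ᵥ x) i).re = (M *ᵥ fun j => (x j).re) i := by
  simp [mulVec, dotProduct]

theorem map_ofReal_mulVec_im (M : Matrix m n ℝ) (x : n → ℂ) (i : m) :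
    ((M.map Complex.ofReal *ᵥ x) i).im = (M *ᵥ fun j => (x j).im) i := by
  simp [mulVec, dotProduct]

theorem map_ofReal_mulVec_eq_iff (M N : Matrix m n ℝ) (x y : n → ℂ) :
    M.map Complex.ofReal *ᵥ x = N.map Complex.ofReal *ᵥ y ↔
      ((M *ᵥ fun j => (x j).re) = N *ᵥ fun j => (y j).re) ∧
      ((M *ᵥ fun j => (x j).im) = N *ᵥ fun j => (y j).im) := by
  simp only [funext_iff, ← map_ofReal_mulVec_re, ← map_ofReal_mulVec_im, Complex.ext_iff,
    forall_and]

theorem map_ofReal_mulVec_eq_zero_iff (M : Matrix m n ℝ) (x : n → ℂ) :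
    M.map Complex.ofReal *ᵥ x = 0 ↔
      (M *ᵥ fun j => (x j).re) = 0 ∧ (M *ᵥ fun j => (x j).im) = 0 := by
  simp only [funext_iff, ← map_ofReal_mulVec_re, ← map_ofReal_mulVec_im, Complex.ext_iff,
    forall_and, Pi.zero_apply, Complex.zero_re, Complex.zero_im]

theorem isUnit_map_ofReal [DecidableEq n] {M : Matrix n n ℝ} (h : IsUnit M) :
    IsUnit (M.map Complex.ofReal) :=
  h.map (Complex.ofRealHom.mapMatrix : Matrix n n ℝ →+* Matrix n n ℂ)

end Complexify

/-! ### Dissipative Hamiltonian coefficients -/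

section DissipativeHamiltonian

variable {ι : Type*} [Fintype ι] {E J R : Matrix ι ι ℝ}

theorem dotProduct_mulVec_self_of_transpose_eq_neg (hJ : Jᵀ = -J) (v : ι → ℝ) :
    v ⬝ᵥ J *ᵥ v = 0 := by
  have h : v ⬝ᵥ J *ᵥ v = -(v ⬝ᵥ J *ᵥ v) := by
    conv_lhs => rw [dotProduct_mulVec, ← mulVec_transpose, hJ, neg_mulVec, neg_dotProduct,
      dotProduct_comm]
  linarith

theorem IsDHDAE.dotProduct_mulVec_sub (h : IsDHDAE E J R) (v : ι → ℝ) :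
    v ⬝ᵥ (J - R) *ᵥ v = -(v ⬝ᵥ R *ᵥ v) := by
  rw [sub_mulVec, dotProduct_sub, dotProduct_mulVec_self_of_transpose_eq_neg h.J_skew, zero_sub]

theorem Matrix.PosSemidef.real_dotProduct_nonneg (h : R.PosSemidef) (v : ι → ℝ) :
    0 ≤ v ⬝ᵥ R *ᵥ v := by
  simpa using h.dotProduct_mulVec_nonneg v

theorem Matrix.PosSemidef.mulVec_eq_zero_of_real (h : R.PosSemidef) {v : ι → ℝ}
    (hv : v ⬝ᵥ R *ᵥ v = 0) : R *ᵥ v = 0 :=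
  (h.dotProduct_mulVec_zero_iff v).1 (by simpa using hv)

/-- For dissipative Hamiltonian coefficients, the kernel of `E - (J - R)` is the common kernel of
`E`, `J` and `R`: pairing `E v = (J - R) v` with `v` gives `vᵀ E v + vᵀ R v = 0`. -/
theorem IsDHDAE.mulVec_eq_zero_of_eq (h : IsDHDAE E J R) {v : ι → ℝ}
    (hv : E *ᵥ v = (J - R) *ᵥ v) : E *ᵥ v = 0 ∧ J *ᵥ v = 0 ∧ R *ᵥ v = 0 := by
  have h1 := h.dotProduct_mulVec_sub v
  rw [← hv] at h1
  have hE := h.E_posSemidef.real_dotProduct_nonneg v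
  have hR := h.R_posSemidef.real_dotProduct_nonneg v
  have hE0 := h.E_posSemidef.mulVec_eq_zero_of_real (v := v) (by linarith)
  have hR0 := h.R_posSemidef.mulVec_eq_zero_of_real (v := v) (by linarith)
  refine ⟨hE0, ?_, hR0⟩
  rw [hE0, sub_mulVec, hR0, sub_zero] at hv
  exact hv.symm

/-- The difference of two solutions with the same initial value lies in the kernels of `E` and of
`J - R` at all times: the energy `dᵀ E d` is nonnegative, starts at `0`, and is nonincreasing. -/
theorem IsDHDAE.mulVec_sub_eq_zero (h : IsDHDAE E J R) {t₀ t₁ : ℝ} (ht : t₀ < t₁)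
    {z z' : ℝ → ι → ℝ} (hz : IsDAESolution E (J - R) t₀ t₁ z)
    (hz' : IsDAESolution E (J - R) t₀ t₁ z') (h0 : z t₀ = z' t₀) {t : ℝ}
    (htt : t ∈ Icc t₀ t₁) :
    E *ᵥ (z t - z' t) = 0 ∧ (J - R) *ᵥ (z t - z' t) = 0 := by
  have hu : UniqueDiffOn ℝ (Icc t₀ t₁) := uniqueDiffOn_Icc ht
  let d : ℝ → ι → ℝ := fun s => z s - z' s
  let d' : ℝ → ι → ℝ := fun s => derivWithin z (Icc t₀ t₁) s - derivWithin z' (Icc t₀ t₁) s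
  have hd : ∀ s ∈ Icc t₀ t₁, HasDerivWithinAt d (d' s) (Icc t₀ t₁) s := fun s hs =>
    ((hz.contDiffOn.differentiableOn one_ne_zero s hs).hasDerivWithinAt).sub
      ((hz'.contDiffOn.differentiableOn one_ne_zero s hs).hasDerivWithinAt)
  have heq : ∀ s ∈ Icc t₀ t₁, E *ᵥ d' s = (J - R) *ᵥ d s := by
    intro s hs
    rw [mulVec_sub, mulVec_sub, hz.eqn s hs, hz'.eqn s hs]
  have hEd : ∀ s ∈ Icc t₀ t₁, HasDerivWithinAt (fun s => E *ᵥ d s) (E *ᵥ d' s) (Icc t₀ t₁) s :=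
    fun s hs => (LinearMap.toContinuousLinearMap
      (Matrix.mulVecLin E)).hasFDerivAt.comp_hasDerivWithinAt s (hd s hs)
  have hsymm : ∀ x y : ι → ℝ, x ⬝ᵥ E *ᵥ y = y ⬝ᵥ E *ᵥ x := by
    intro x y
    have hE : Eᵀ = E := by simpa using h.E_posSemidef.isHermitian.eq
    rw [dotProduct_mulVec, ← mulVec_transpose, hE, dotProduct_comm]
  have hV : ∀ s ∈ Icc t₀ t₁, HasDerivWithinAt (fun s => d s ⬝ᵥ E *ᵥ d s)
      (-2 * (d s ⬝ᵥ R *ᵥ d s)) (Icc t₀ t₁) s := by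
    intro s hs
    have h1 : HasDerivWithinAt (fun s => ∑ i, d s i * (E *ᵥ d s) i)
        (∑ i, (d' s i * (E *ᵥ d s) i + d s i * (E *ᵥ d' s) i)) (Icc t₀ t₁) s :=
      HasDerivWithinAt.fun_sum fun i _ =>
        (hasDerivWithinAt_pi.1 (hd s hs) i).mul (hasDerivWithinAt_pi.1 (hEd s hs) i)
    refine h1.congr_deriv ?_
    rw [Finset.sum_add_distrib]
    change d' s ⬝ᵥ E *ᵥ d s + d s ⬝ᵥ E *ᵥ d' s = _
    rw [hsymm (d' s), heq s hs, h.dotProduct_mulVec_sub]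
    ring
  have hanti : AntitoneOn (fun s => d s ⬝ᵥ E *ᵥ d s) (Icc t₀ t₁) :=
    antitoneOn_of_hasDerivWithinAt_nonpos (convex_Icc _ _)
      (fun s hs => (hV s hs).continuousWithinAt)
      (fun s hs => (hV s (interior_subset hs)).mono interior_subset)
      (fun s _ => by
        have := h.R_posSemidef.real_dotProduct_nonneg (d s)
        linarith)
  have hd0 : d t₀ = 0 := sub_eq_zero.2 h0
  have hE0 : ∀ s ∈ Icc t₀ t₁, E *ᵥ d s = 0 := by
    intro s hs
    apply h.E_posSemidef.mulVec_eq_zero_of_real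
    refine le_antisymm ?_ (h.E_posSemidef.real_dotProduct_nonneg _)
    have := hanti (left_mem_Icc.2 ht.le) hs hs.1
    simpa [hd0] using this
  refine ⟨hE0 t htt, ?_⟩
  -- `E d` vanishes identically, hence so does its derivative `E ḋ = (J - R) d`
  have hconst : HasDerivWithinAt (fun s => E *ᵥ d s) 0 (Icc t₀ t₁) t :=
    (hasDerivWithinAt_const t (Icc t₀ t₁) (0 : ι → ℝ)).congr hE0 (hE0 t htt)
  exact (heq t htt).symm.trans ((hu t htt).eq_deriv _ (hEd t htt) hconst)

variable [DecidableEq ι]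

/-- If the pencil is singular then it is so at `λ = 1`, where the kernel is the common one. -/
theorem IsDHDAE.not_isRegularPencil_iff (h : IsDHDAE E J R) :
    ¬ IsRegularPencil (E.map Complex.ofReal) ((J - R).map Complex.ofReal) ↔
      ∃ v : ι → ℝ, v ≠ 0 ∧ E *ᵥ v = 0 ∧ J *ᵥ v = 0 ∧ R *ᵥ v = 0 := by
  constructor
  · intro hreg
    by_contra! hker
    refine hreg ⟨1, ?_⟩
    have hmap : (1 : ℂ) • E.map Complex.ofReal - (J - R).map Complex.ofReal =
        Complex.ofRealHom.mapMatrix (E - (J - R)) := by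
      ext i j
      simp
    rw [hmap, ← RingHom.map_det, Ne, map_eq_zero]
    intro hdet
    obtain ⟨v, hv, hv0⟩ := exists_mulVec_eq_zero_iff.2 hdet
    rw [sub_mulVec, sub_eq_zero] at hv0
    obtain ⟨h1, h2, h3⟩ := h.mulVec_eq_zero_of_eq hv0
    exact hker v hv h1 h2 h3
  · rintro ⟨v, hv, hE, hJ, hR⟩ ⟨c, hc⟩
    have hA : (J - R) *ᵥ v = 0 := by rw [sub_mulVec, hJ, hR, sub_zero]
    have hmap : ∀ M : Matrix ι ι ℝ, M *ᵥ v = 0 →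
        M.map Complex.ofReal *ᵥ (fun i => (v i : ℂ)) = 0 := fun M hM => by
      rw [map_ofReal_mulVec_ofReal, hM]
      exact funext fun _ => Complex.ofReal_zero
    refine hc (exists_mulVec_eq_zero_iff.1 ⟨fun i => (v i : ℂ), fun h0 => hv ?_, ?_⟩)
    · funext i
      simpa using congrFun h0 i
    · rw [sub_mulVec, smul_mulVec, hmap E hE, hmap _ hA, smul_zero, sub_zero]

end DissipativeHamiltonian

/-! ### The staircase form -/

namespace StairIdx

variable {n₁ n₂ n₃ n₅ : ℕ}

theorem sum_stairIdx (f : StairIdx n₁ n₂ n₃ n₅ → ℝ) :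
    ∑ i, f i = ∑ i, f (b1 i) + (∑ i, f (b2 i) + (∑ i, f (b3 i) +
      (∑ i, f (b4 i) + ∑ i, f (b5 i)))) := by
  simp only [Fintype.sum_sum_type]
  rfl

/-- The colouring of the indices that singles out the fifth block. -/
def isFifth : StairIdx n₁ n₂ n₃ n₅ → Bool
  | Sum.inr (Sum.inr (Sum.inr (Sum.inr _))) => true
  | _ => false

theorem exists_eq_b5 {i : StairIdx n₁ n₂ n₃ n₅} (h : isFifth i = true) : ∃ k, i = b5 k := by
  rcases i with i | i | i | i | i
  · simp [isFifth] at h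
  · simp [isFifth] at h
  · simp [isFifth] at h
  · simp [isFifth] at h
  · exact ⟨i, rfl⟩

theorem replace5_b5 (z : StairIdx n₁ n₂ n₃ n₅ → ℝ) (w : Fin n₅ → ℝ) (k) :
    replace5 z w (b5 k) = w k := rfl

theorem replace5_of_not (z : StairIdx n₁ n₂ n₃ n₅ → ℝ) (w : Fin n₅ → ℝ)
    {i : StairIdx n₁ n₂ n₃ n₅} (hi : isFifth i ≠ true) : replace5 z w i = z i := by
  rcases i with i | i | i | i | i
  · rfl
  · rfl
  · rfl
  · rfl
  · exact absurd rfl hi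

end StairIdx

namespace IsStaircase

open StairIdx

variable {n₁ n₂ n₃ n₅ : ℕ} {E J R : Matrix (StairIdx n₁ n₂ n₃ n₅) (StairIdx n₁ n₂ n₃ n₅) ℝ}
  {x y z v : StairIdx n₁ n₂ n₃ n₅ → ℝ}

theorem E_apply_b345_left (hS : IsStaircase E J R) (i) (j) : E (b345 i) j = 0 :=
  congrFun (congrFun hS.E_bot i) j

theorem E_apply_b345_right (hS : IsStaircase E J R) (i) (j) : E j (b345 i) = 0 := by
  have h : Eᵀ = E := by simpa using hS.E_posSemidef.isHermitian.eq
  rw [← h]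
  exact hS.E_apply_b345_left i j

theorem A_apply_b5_right (hS : IsStaircase E J R) (i) (j) : (J - R) j (b5 i) = 0 :=
  congrFun (congrFun hS.A_col5 j) i

theorem A_apply_b5_left (hS : IsStaircase E J R) (i) (j) : (J - R) (b5 i) j = 0 :=
  congrFun (congrFun hS.A_row5 i) j

theorem A_apply_b4_b1 (hS : IsStaircase E J R) (i j) : (J - R) (b4 i) (b1 j) = J (b4 i) (b1 j) := by
  have h : R (b4 i) (b1 j) = 0 := congrFun (congrFun hS.R_41 i) j
  rw [Matrix.sub_apply, h, sub_zero]

theorem A_apply_b1_b4 (hS : IsStaircase E J R) (i j) :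
    (J - R) (b1 i) (b4 j) = -J (b4 j) (b1 i) := by
  have h : R (b1 i) (b4 j) = 0 := congrFun (congrFun hS.R_14 i) j
  have hJ : J (b1 i) (b4 j) = -J (b4 j) (b1 i) :=
    congrFun (congrFun hS.J_skew (b4 j)) (b1 i)
  rw [Matrix.sub_apply, h, sub_zero, hJ]

/-- The kernel of `E` consists of the vectors whose first two blocks vanish. -/
theorem E_mulVec_eq_zero_iff (hS : IsStaircase E J R) :
    E *ᵥ x = 0 ↔ (∀ i, x (b1 i) = 0) ∧ ∀ i, x (b2 i) = 0 := by
  constructor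
  · intro hx
    have h : E.submatrix b12 b12 *ᵥ (x ∘ b12) = 0 := by
      funext i
      have hi := congrFun hx (b12 i)
      simp only [mulVec, dotProduct, Pi.zero_apply] at hi ⊢
      rw [← hi, sum_stairIdx, Fintype.sum_sum_type]
      have h3 : ∀ k, E (b12 i) (b3 k) = 0 := fun k => hS.E_apply_b345_right (Sum.inl k) _
      have h4 : ∀ k, E (b12 i) (b4 k) = 0 :=
        fun k => hS.E_apply_b345_right (Sum.inr (Sum.inl k)) _
      have h5 : ∀ k, E (b12 i) (b5 k) = 0 :=
        fun k => hS.E_apply_b345_right (Sum.inr (Sum.inr k)) _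
      simp only [h3, h4, h5, zero_mul, Finset.sum_const_zero, add_zero]
      rfl
    have h0 : x ∘ b12 = 0 := by
      by_contra hne
      have := hS.E_lead.dotProduct_mulVec_pos hne
      rw [h, dotProduct_zero] at this
      exact lt_irrefl _ this
    exact ⟨fun i => congrFun h0 (Sum.inl i), fun i => congrFun h0 (Sum.inr i)⟩
  · rintro ⟨h1, h2⟩
    funext i
    simp only [mulVec, dotProduct, Pi.zero_apply]
    have h3 : ∀ k, E i (b3 k) = 0 := fun k => hS.E_apply_b345_right (Sum.inl k) _
    have h4 : ∀ k, E i (b4 k) = 0 := fun k => hS.E_apply_b345_right (Sum.inr (Sum.inl k)) _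
    have h5 : ∀ k, E i (b5 k) = 0 := fun k => hS.E_apply_b345_right (Sum.inr (Sum.inr k)) _
    rw [sum_stairIdx]
    simp [h1, h2, h3, h4, h5]

theorem E_mulVec_b345 (hS : IsStaircase E J R) (i) : (E *ᵥ x) (b345 i) = 0 := by
  simp [mulVec, dotProduct, hS.E_apply_b345_left]

theorem A_mulVec_b3 (hS : IsStaircase E J R) (hx : E *ᵥ x = 0) (i) :
    ((J - R) *ᵥ x) (b3 i) = ((J - R).submatrix b3 b3 *ᵥ fun j => x (b3 j)) i := by
  obtain ⟨h1, h2⟩ := hS.E_mulVec_eq_zero_iff.1 hx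
  have h4 : ∀ k, (J - R) (b3 i) (b4 k) = 0 := fun k => congrFun (congrFun hS.A_34 i) k
  have h5 : ∀ k, (J - R) (b3 i) (b5 k) = 0 := fun k => hS.A_apply_b5_right k _
  simp only [mulVec, dotProduct]
  rw [sum_stairIdx]
  simp only [h1, h2, h4, h5, mul_zero, zero_mul, Finset.sum_const_zero, add_zero, zero_add]
  rfl

theorem A_mulVec_b4 (hS : IsStaircase E J R) (i) :
    ((J - R) *ᵥ x) (b4 i) = (J.submatrix b4 b1 *ᵥ fun j => x (b1 j)) i := by
  have h2 : ∀ k, (J - R) (b4 i) (b2 k) = 0 := fun k => congrFun (congrFun hS.A_42 i) k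
  have h3 : ∀ k, (J - R) (b4 i) (b3 k) = 0 := fun k => congrFun (congrFun hS.A_43 i) k
  have h4 : ∀ k, (J - R) (b4 i) (b4 k) = 0 := fun k => congrFun (congrFun hS.A_44 i) k
  have h5 : ∀ k, (J - R) (b4 i) (b5 k) = 0 := fun k => hS.A_apply_b5_right k _
  simp only [mulVec, dotProduct]
  rw [sum_stairIdx]
  simp only [h2, h3, h4, h5, hS.A_apply_b4_b1, zero_mul, Finset.sum_const_zero, add_zero]
  rfl

/-- Third row of `A x = E y` for `x ∈ ker E`: it reads `A₃₃ x₃ = 0`. -/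
theorem b3_eq_zero (hS : IsStaircase E J R) (hx : E *ᵥ x = 0) (hy : (J - R) *ᵥ x = E *ᵥ y) (i) :
    x (b3 i) = 0 := by
  have h : (J - R).submatrix b3 b3 *ᵥ (fun j => x (b3 j)) = 0 := by
    funext i
    rw [← hS.A_mulVec_b3 hx, hy]
    exact hS.E_mulVec_b345 (Sum.inl i)
  have h0 := Matrix.mulVec_injective_of_isUnit hS.A_33 (h.trans (mulVec_zero _).symm)
  exact congrFun h0 i

/-- Fourth row of `A y = E z`: it reads `J₄₁ y₁ = 0`. -/
theorem b1_eq_zero (hS : IsStaircase E J R) (hy : (J - R) *ᵥ y = E *ᵥ z) (i) :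
    y (b1 i) = 0 := by
  have h : J.submatrix b4 b1 *ᵥ (fun j => y (b1 j)) = 0 := by
    funext i
    rw [← hS.A_mulVec_b4, hy]
    exact hS.E_mulVec_b345 (Sum.inr (Sum.inl i))
  have h0 := Matrix.mulVec_injective_of_isUnit hS.J_41 (h.trans (mulVec_zero _).symm)
  exact congrFun h0 i

/-- On vectors supported on the last two blocks only `A₁₄` acts. -/
theorem A_mulVec_of_ker (hS : IsStaircase E J R) (hx : E *ᵥ x = 0) (h3 : ∀ i, x (b3 i) = 0) (r) :
    ((J - R) *ᵥ x) r = ∑ j, (J - R) r (b4 j) * x (b4 j) := by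
  obtain ⟨h1, h2⟩ := hS.E_mulVec_eq_zero_iff.1 hx
  have h5 : ∀ k, (J - R) r (b5 k) = 0 := fun k => hS.A_apply_b5_right k _
  simp only [mulVec, dotProduct]
  rw [sum_stairIdx]
  simp only [h1, h2, h3, h5, mul_zero, zero_mul, Finset.sum_const_zero, add_zero, zero_add]

theorem A_mulVec_eq_zero_off_b1 (hS : IsStaircase E J R) (hx : E *ᵥ x = 0)
    (h3 : ∀ i, x (b3 i) = 0) (r) : ((J - R) *ᵥ x) (Sum.inr r) = 0 := by
  rw [hS.A_mulVec_of_ker hx h3]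
  refine Finset.sum_eq_zero fun j _ => ?_
  have h : (J - R) (Sum.inr r) (b4 j) = 0 := by
    rcases r with i | i | i | i
    · exact congrFun (congrFun hS.A_24 i) j
    · exact congrFun (congrFun hS.A_34 i) j
    · exact congrFun (congrFun hS.A_44 i) j
    · exact hS.A_apply_b5_left i _
  rw [h, zero_mul]

/-- There is no chain of length three at infinity: `x₃ = 0`, so `A x` lives in the first block,
and `y₁ = 0`; hence `yᵀ E y = yᵀ A x = 0`, so that `A x = E y = 0`. -/
theorem no_chain_three (hS : IsStaircase E J R) (hx : E *ᵥ x = 0) (hy : (J - R) *ᵥ x = E *ᵥ y)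
    (hz : (J - R) *ᵥ y = E *ᵥ z) : (J - R) *ᵥ x = 0 := by
  have h3 := hS.b3_eq_zero hx hy
  have h1 := hS.b1_eq_zero hz
  rw [hy]
  apply hS.E_posSemidef.mulVec_eq_zero_of_real
  rw [← hy]
  refine Finset.sum_eq_zero fun r _ => ?_
  rcases r with i | r
  · have : y (Sum.inl i) = 0 := h1 i
    rw [this, zero_mul]
  · rw [hS.A_mulVec_eq_zero_off_b1 hx h3, mul_zero]

theorem no_chain_two (hS : IsStaircase E J R) (h : n₁ = 0) (hx : E *ᵥ x = 0)
    (hy : (J - R) *ᵥ x = E *ᵥ y) : (J - R) *ᵥ x = 0 := by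
  subst h
  funext r
  rcases r with i | r
  · exact i.elim0
  · exact hS.A_mulVec_eq_zero_off_b1 hx (hS.b3_eq_zero hx hy) r

theorem no_chain_one (hS : IsStaircase E J R) (h1 : n₁ = 0) (h3 : n₃ = 0) (hx : E *ᵥ x = 0) :
    (J - R) *ᵥ x = 0 := by
  subst h1 h3
  funext r
  rcases r with i | r
  · exact i.elim0
  · exact hS.A_mulVec_eq_zero_off_b1 hx (fun i => i.elim0) r

theorem E_mulVec_single_b345 (hS : IsStaircase E J R) (i) : E *ᵥ Pi.single (b345 i) 1 = 0 := by
  rw [mulVec_single_one]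
  funext j
  exact hS.E_apply_b345_right i j

/-- A vector in the third block: `A₃₃` is nonsingular. -/
theorem exists_chain_one (hS : IsStaircase E J R) (h : 0 < n₃) :
    ∃ x, E *ᵥ x = 0 ∧ (J - R) *ᵥ x ≠ 0 := by
  refine ⟨_, hS.E_mulVec_single_b345 (Sum.inl ⟨0, h⟩), fun h0 => ?_⟩
  rw [mulVec_single_one] at h0
  refine ((Matrix.isUnit_iff_isUnit_det _).1 hS.A_33).ne_zero ?_
  exact det_eq_zero_of_column_eq_zero ⟨0, h⟩ fun i => congrFun h0 (b3 i)

/-- A vector `x` in the fourth block: `A x = (A₁₄ x₄, 0, 0, 0, 0)` is nonzero and, the leading part of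
`E` being invertible, lies in the range of `E`. -/
theorem exists_chain_two (hS : IsStaircase E J R) (h : 0 < n₁) :
    ∃ x y, E *ᵥ x = 0 ∧ (J - R) *ᵥ x = E *ᵥ y ∧ (J - R) *ᵥ x ≠ 0 := by
  have hE := hS.E_mulVec_single_b345 (Sum.inr (Sum.inl ⟨0, h⟩))
  set x : StairIdx n₁ n₂ n₃ n₅ → ℝ := Pi.single (b345 (Sum.inr (Sum.inl ⟨0, h⟩))) 1 with hx
  have h3 : ∀ i, x (b3 i) = 0 := fun i => Pi.single_eq_of_ne (by simp [b3, b345]) _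
  obtain ⟨w, hw⟩ := (Matrix.mulVec_surjective_iff_isUnit.2 hS.E_lead.isUnit)
    (((J - R) *ᵥ x) ∘ b12)
  let y : StairIdx n₁ n₂ n₃ n₅ → ℝ :=
    Sum.elim (fun i => w (Sum.inl i)) (Sum.elim (fun i => w (Sum.inr i)) 0)
  have hy : ∀ i, (E *ᵥ y) (b12 i) = (E.submatrix b12 b12 *ᵥ w) i := by
    intro i
    simp only [mulVec, dotProduct]
    rw [sum_stairIdx, Fintype.sum_sum_type]
    simp only [y, b1, b2, b3, b4, b5, Sum.elim_inl, Sum.elim_inr, Pi.zero_apply, mul_zero,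
      Finset.sum_const_zero, add_zero]
    rfl
  refine ⟨x, y, hE, ?_, fun h0 => ?_⟩
  · funext r
    rcases r with i | i | r
    · exact (congrFun hw (Sum.inl i)).symm.trans (hy (Sum.inl i)).symm
    · exact (congrFun hw (Sum.inr i)).symm.trans (hy (Sum.inr i)).symm
    · exact (hS.A_mulVec_eq_zero_off_b1 hE h3 _).trans (hS.E_mulVec_b345 r).symm
  · rw [hx, mulVec_single_one] at h0
    refine ((Matrix.isUnit_iff_isUnit_det _).1 hS.J_41).ne_zero ?_
    refine det_eq_zero_of_row_eq_zero ⟨0, h⟩ fun i => ?_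
    exact neg_eq_zero.1 ((hS.A_apply_b1_b4 i ⟨0, h⟩).symm.trans (congrFun h0 (b1 i)))

/-- `ker E ∩ ker (J - R)` consists of the vectors supported on the fifth block. -/
theorem eq_zero_of_ker (hS : IsStaircase E J R) (hE : E *ᵥ v = 0) (hA : (J - R) *ᵥ v = 0)
    (i) (hi : ∀ k, i ≠ b5 k) : v i = 0 := by
  obtain ⟨h1, h2⟩ := hS.E_mulVec_eq_zero_iff.1 hE
  have h3 := hS.b3_eq_zero (y := 0) hE (by rw [hA, mulVec_zero])
  rcases i with i | i | i | i | i
  · exact h1 i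
  · exact h2 i
  · exact h3 i
  · have h : (J.submatrix b4 b1)ᵀ *ᵥ (fun j => v (b4 j)) = 0 := by
      funext k
      have hk := congrFun hA (b1 k)
      rw [hS.A_mulVec_of_ker hE h3] at hk
      simp only [hS.A_apply_b1_b4, neg_mul, Finset.sum_neg_distrib] at hk
      exact neg_eq_zero.1 hk
    have hu : IsUnit (J.submatrix b4 b1)ᵀ := by
      rw [Matrix.isUnit_iff_isUnit_det, det_transpose, ← Matrix.isUnit_iff_isUnit_det]
      exact hS.J_41
    have h0 := Matrix.mulVec_injective_of_isUnit hu (h.trans (mulVec_zero _).symm)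
    exact congrFun h0 i
  · exact absurd rfl (hi i)

end IsStaircase

/-! ### Kronecker form, index and solutions in staircase form -/

namespace IsStaircase

open StairIdx

variable {n₁ n₂ n₃ n₅ : ℕ} {E J R : Matrix (StairIdx n₁ n₂ n₃ n₅) (StairIdx n₁ n₂ n₃ n₅) ℝ}
  {t₀ t₁ : ℝ}

theorem E_apply_eq_zero (hS : IsStaircase E J R) {i j : StairIdx n₁ n₂ n₃ n₅}
    (h : isFifth i = true ∨ isFifth j = true) : E i j = 0 := by
  rcases h with h | h
  · obtain ⟨k, rfl⟩ := exists_eq_b5 h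
    exact hS.E_apply_b345_left (Sum.inr (Sum.inr k)) j
  · obtain ⟨k, rfl⟩ := exists_eq_b5 h
    exact hS.E_apply_b345_right (Sum.inr (Sum.inr k)) i

theorem A_apply_eq_zero (hS : IsStaircase E J R) {i j : StairIdx n₁ n₂ n₃ n₅}
    (h : isFifth i = true ∨ isFifth j = true) : (J - R) i j = 0 := by
  rcases h with h | h
  · obtain ⟨k, rfl⟩ := exists_eq_b5 h
    exact hS.A_apply_b5_left k j
  · obtain ⟨k, rfl⟩ := exists_eq_b5 h
    exact hS.A_apply_b5_right k i

/-- Off the fifth block, `E - (J - R)` is invertible. -/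
theorem isUnit_sub_submatrix (hS : IsStaircase E J R) :
    IsUnit (((E - (J - R)).submatrix Subtype.val Subtype.val :
      Matrix {i : StairIdx n₁ n₂ n₃ n₅ // isFifth i = false} {i // isFifth i = false} ℝ)) := by
  rw [Matrix.isUnit_iff_isUnit_det, isUnit_iff_ne_zero]
  intro hdet
  obtain ⟨w, hw, hw0⟩ := exists_mulVec_eq_zero_iff.2 hdet
  let v : StairIdx n₁ n₂ n₃ n₅ → ℝ := fun i => if h : isFifth i = false then w ⟨i, h⟩ else 0
  have hv : (E - (J - R)) *ᵥ v = 0 := by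
    funext i
    by_cases hi : isFifth i = false
    · refine Eq.trans ?_ (congrFun hw0 ⟨i, hi⟩)
      simp only [mulVec, dotProduct, submatrix_apply]
      rw [← Fintype.sum_subtype_add_sum_subtype (fun j => isFifth j = false)]
      rw [Fintype.sum_eq_zero (fun j : {j // ¬ isFifth j = false} => _), add_zero]
      · exact Fintype.sum_congr _ _ fun j => by simp [v, j.2]
      · intro j
        simp [v, j.2]
    · rw [Bool.not_eq_false] at hi
      refine Finset.sum_eq_zero (s := Finset.univ) (f := fun j => (E - (J - R)) i j * v j)
        fun j _ => ?_
      rw [Matrix.sub_apply, hS.E_apply_eq_zero (Or.inl hi), hS.A_apply_eq_zero (Or.inl hi),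
        sub_zero, zero_mul]
  rw [sub_mulVec, sub_eq_zero] at hv
  have hE := (hS.toIsDHDAE.mulVec_eq_zero_of_eq hv).1
  refine hw (funext fun i => ?_)
  have h := hS.eq_zero_of_ker hE (hv.symm.trans hE) i.1 (fun k hk => by
    have := i.2
    rw [hk] at this
    exact Bool.noConfusion this)
  simpa [v, i.2] using h

/-- The pencil splits into the zero pencil on the fifth block and a pencil with `E - A` invertible on
the others. -/
theorem hasKroneckerForm (hS : IsStaircase E J R) :
    HasKroneckerForm (E.map Complex.ofReal) ((J - R).map Complex.ofReal) := by
  have hE : ∀ i j : StairIdx n₁ n₂ n₃ n₅, (isFifth i = true ∨ isFifth j = true) →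
      (E.map Complex.ofReal) i j = 0 := fun i j h => by
    rw [map_apply, hS.E_apply_eq_zero h, Complex.ofReal_zero]
  have hA : ∀ i j : StairIdx n₁ n₂ n₃ n₅, (isFifth i = true ∨ isFifth j = true) →
      ((J - R).map Complex.ofReal) i j = 0 := fun i j h => by
    rw [map_apply, hS.A_apply_eq_zero h, Complex.ofReal_zero]
  have hor : ∀ i j : StairIdx n₁ n₂ n₃ n₅, isFifth i ≠ isFifth j →
      (isFifth i = true ∨ isFifth j = true) := by
    intro i j h
    cases hi : isFifth i <;> cases hj : isFifth j <;> simp_all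
  refine hasKroneckerForm_of_fibers isFifth (fun i j h => hE i j (hor i j h))
    (fun i j h => hA i j (hor i j h)) fun k => ?_
  cases k with
  | true =>
    have hE0 : ((E.map Complex.ofReal).submatrix Subtype.val Subtype.val :
        Matrix {i : StairIdx n₁ n₂ n₃ n₅ // isFifth i = true} {i // isFifth i = true} ℂ) = 0 :=
      Matrix.ext fun i j => hE i j (Or.inl i.2)
    have hA0 : (((J - R).map Complex.ofReal).submatrix Subtype.val Subtype.val :
        Matrix {i : StairIdx n₁ n₂ n₃ n₅ // isFifth i = true} {i // isFifth i = true} ℂ) = 0 :=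
      Matrix.ext fun i j => hA i j (Or.inl i.2)
    rw [hE0, hA0]
    exact hasKroneckerForm_zero
  | false =>
    refine hasKroneckerForm_of_isUnit_sub ?_
    convert isUnit_map_ofReal hS.isUnit_sub_submatrix using 1
    ext i j
    simp

/-- The index is determined by the block sizes: the chains at infinity of the real pencil carry
over to the complexified one, and these detect the largest nilpotent block. -/
theorem index_trichotomy (hS : IsStaircase E J R) {ν : ℕ}
    (hν : IsKroneckerIndex (E.map Complex.ofReal) ((J - R).map Complex.ofReal) ν) :
    (ν = 0 ∧ n₁ = 0 ∧ n₃ = 0) ∨ (ν = 1 ∧ n₁ = 0 ∧ 0 < n₃) ∨ (ν = 2 ∧ 0 < n₁) := by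
  obtain ⟨k, b, hb, rfl⟩ := hν
  have h0 : ∀ x, E.map Complex.ofReal *ᵥ x = (J - R).map Complex.ofReal *ᵥ x →
      E.map Complex.ofReal *ᵥ x = 0 := by
    intro x hx
    rw [map_ofReal_mulVec_eq_iff] at hx
    rw [map_ofReal_mulVec_eq_zero_iff]
    exact ⟨(hS.toIsDHDAE.mulVec_eq_zero_of_eq hx.1).1, (hS.toIsDHDAE.mulVec_eq_zero_of_eq hx.2).1⟩
  have hcast : ∀ (M : Matrix (StairIdx n₁ n₂ n₃ n₅) (StairIdx n₁ n₂ n₃ n₅) ℝ)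
      (x : StairIdx n₁ n₂ n₃ n₅ → ℝ), M *ᵥ x ≠ 0 →
      M.map Complex.ofReal *ᵥ (fun i => (x i : ℂ)) ≠ 0 := by
    intro M x hx h
    rw [map_ofReal_mulVec_eq_zero_iff] at h
    exact hx h.1
  rcases Nat.eq_zero_or_pos n₁ with h1 | h1
  · rcases Nat.eq_zero_or_pos n₃ with h3 | h3
    · refine Or.inl ⟨?_, h1, h3⟩
      refine Nat.le_zero.1 (Finset.sup_le fun i _ => (hb.nilpSize_eq_zero (fun x hx => ?_) i).le)
      rw [map_ofReal_mulVec_eq_zero_iff] at hx ⊢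
      exact ⟨hS.no_chain_one h1 h3 hx.1, hS.no_chain_one h1 h3 hx.2⟩
    · refine Or.inr (Or.inl ⟨le_antisymm (Finset.sup_le fun i _ =>
        hb.nilpSize_le_one (fun x y hx hy => ?_) i) ?_, h1, h3⟩)
      · rw [map_ofReal_mulVec_eq_zero_iff] at hx ⊢
        rw [map_ofReal_mulVec_eq_iff] at hy
        exact ⟨hS.no_chain_two h1 hx.1 hy.1, hS.no_chain_two h1 hx.2 hy.2⟩
      · obtain ⟨x, hx, hx'⟩ := hS.exists_chain_one h3
        obtain ⟨i, hi⟩ := hb.exists_one_le_nilpSize h0 (x := fun i => (x i : ℂ))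
          (by rw [map_ofReal_mulVec_ofReal, hx]; rfl) (hcast _ _ hx')
        exact hi.trans (Finset.le_sup (f := fun i => (b i).nilpSize) (Finset.mem_univ i))
  · refine Or.inr (Or.inr ⟨le_antisymm (Finset.sup_le fun i _ =>
      hb.nilpSize_le_two (fun x y z hx hy hz => ?_) i) ?_, h1⟩)
    · rw [map_ofReal_mulVec_eq_zero_iff] at hx ⊢
      rw [map_ofReal_mulVec_eq_iff] at hy hz
      exact ⟨hS.no_chain_three hx.1 hy.1 hz.1, hS.no_chain_three hx.2 hy.2 hz.2⟩
    · obtain ⟨x, y, hx, hy, hx'⟩ := hS.exists_chain_two h1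
      obtain ⟨i, hi⟩ := hb.exists_two_le_nilpSize h0 (x := fun i => (x i : ℂ))
        (y := fun i => (y i : ℂ))
        (by rw [map_ofReal_mulVec_ofReal, hx]; rfl)
        (by rw [map_ofReal_mulVec_ofReal, map_ofReal_mulVec_ofReal, hy]) (hcast _ _ hx')
      exact hi.trans (Finset.le_sup (f := fun i => (b i).nilpSize) (Finset.mem_univ i))

theorem isIVPSolution_replace5 (hS : IsStaircase E J R) {z₀ : StairIdx n₁ n₂ n₃ n₅ → ℝ}
    {z : ℝ → StairIdx n₁ n₂ n₃ n₅ → ℝ} (ht : t₀ < t₁)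
    (hz : IsIVPSolution E (J - R) t₀ t₁ z₀ z) {w : ℝ → Fin n₅ → ℝ}
    (hw : ContDiffOn ℝ 1 w (Icc t₀ t₁)) :
    IsIVPSolution E (J - R) t₀ t₁ (replace5 z₀ (w t₀)) fun t => replace5 (z t) (w t) := by
  have hcongr : ∀ (M : Matrix (StairIdx n₁ n₂ n₃ n₅) (StairIdx n₁ n₂ n₃ n₅) ℝ),
      (∀ i j, isFifth j = true → M i j = 0) → ∀ x y : StairIdx n₁ n₂ n₃ n₅ → ℝ,
      (∀ i, isFifth i ≠ true → x i = y i) → M *ᵥ x = M *ᵥ y := by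
    intro M hM x y hxy
    funext i
    refine Finset.sum_congr (s₁ := Finset.univ) (f := fun j => M i j * x j)
      (g := fun j => M i j * y j) rfl fun j _ => ?_
    by_cases hj : isFifth j = true
    · rw [hM i j hj, zero_mul, zero_mul]
    · rw [hxy j hj]
  have hcd : ContDiffOn ℝ 1 (fun t => replace5 (z t) (w t)) (Icc t₀ t₁) := by
    rw [contDiffOn_pi]
    intro i
    by_cases hi : isFifth i = true
    · obtain ⟨k, rfl⟩ := exists_eq_b5 hi
      exact contDiffOn_pi.1 hw k
    · simp only [replace5_of_not _ _ hi]
      exact contDiffOn_pi.1 hz.1.contDiffOn i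
  refine ⟨⟨hcd, fun t htt => ?_⟩, by beta_reduce; rw [hz.2]⟩
  have hu := uniqueDiffOn_Icc ht t htt
  rw [hcongr (J - R) (fun i j h => hS.A_apply_eq_zero (Or.inr h)) _ (z t)
    (fun i hi => replace5_of_not _ _ hi), ← hz.1.eqn t htt]
  refine hcongr E (fun i j h => hS.E_apply_eq_zero (Or.inr h)) _ _ fun i hi => ?_
  have h1 := hasDerivWithinAt_pi.1
    (hcd.differentiableOn one_ne_zero t htt).hasDerivWithinAt i
  have h2 := hasDerivWithinAt_pi.1
    (hz.1.contDiffOn.differentiableOn one_ne_zero t htt).hasDerivWithinAt i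
  simp only [replace5_of_not _ _ hi] at h1
  exact hu.eq_deriv _ h1 h2

/-- If `n₅ ≠ 0`, perturbing the fifth block of the zero solution by `t - t₀` destroys uniqueness; if
`n₅ = 0`, the difference of two solutions lies in `ker E ∩ ker (J - R) = 0`. -/
theorem isUniquelySolvable_iff (hS : IsStaircase E J R) (ht : t₀ < t₁) :
    IsUniquelySolvable E (J - R) t₀ t₁ ↔ n₅ = 0 := by
  constructor
  · intro h
    by_contra h5
    have hz : IsIVPSolution E (J - R) t₀ t₁ 0 0 := by
      refine ⟨⟨contDiffOn_const, fun t _ => ?_⟩, rfl⟩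
      have : derivWithin (0 : ℝ → StairIdx n₁ n₂ n₃ n₅ → ℝ) (Icc t₀ t₁) t = 0 :=
        congrFun (derivWithin_fun_const (Icc t₀ t₁) (0 : StairIdx n₁ n₂ n₃ n₅ → ℝ)) t
      rw [this]
      simp
    have hw : ContDiffOn ℝ 1 (fun t (_ : Fin n₅) => t - t₀) (Icc t₀ t₁) :=
      contDiffOn_pi.2 fun _ => contDiffOn_id.sub contDiffOn_const
    have hz' := hS.isIVPSolution_replace5 ht hz hw
    have hinit : replace5 (0 : StairIdx n₁ n₂ n₃ n₅ → ℝ) (fun _ => t₀ - t₀) = 0 := by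
      funext i
      by_cases hi : isFifth i = true
      · obtain ⟨k, rfl⟩ := exists_eq_b5 hi
        rw [replace5_b5, sub_self]
        rfl
      · exact replace5_of_not _ _ hi
    rw [hinit] at hz'
    obtain ⟨y, -, hy⟩ := h 0 ⟨0, hz⟩
    have he := (hy _ hz' (right_mem_Icc.2 ht.le)).trans (hy _ hz (right_mem_Icc.2 ht.le)).symm
    have := congrFun he (b5 ⟨0, Nat.pos_of_ne_zero h5⟩)
    rw [replace5_b5] at this
    have h0 : t₁ - t₀ = 0 := this
    linarith
  · rintro rfl z₀ ⟨z, hz⟩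
    refine ⟨z, hz, fun z' hz' t htt => ?_⟩
    obtain ⟨hE, hA⟩ := hS.toIsDHDAE.mulVec_sub_eq_zero ht hz'.1 hz.1
      (hz'.2.trans hz.2.symm) htt
    exact sub_eq_zero.1 (funext fun i => hS.eq_zero_of_ker hE hA i fun k => k.elim0)

end IsStaircase

theorem mainTheorem3 {n₁ n₂ n₃ n₅ : ℕ}
    (E J R : Matrix (StairIdx n₁ n₂ n₃ n₅) (StairIdx n₁ n₂ n₃ n₅) ℝ)
    (hS : IsStaircase E J R) (t₀ t₁ : ℝ) (ht : t₀ < t₁) :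
    -- (i) unique solvability, and freedom of the fifth block of the state
    ((IsUniquelySolvable E (J - R) t₀ t₁ ↔ n₅ = 0) ∧
      (n₅ ≠ 0 → ∀ (z₀ : StairIdx n₁ n₂ n₃ n₅ → ℝ) (z : ℝ → StairIdx n₁ n₂ n₃ n₅ → ℝ),
        IsIVPSolution E (J - R) t₀ t₁ z₀ z →
        ∀ w : ℝ → Fin n₅ → ℝ, ContDiffOn ℝ 1 w (Set.Icc t₀ t₁) →
          IsIVPSolution E (J - R) t₀ t₁ (StairIdx.replace5 z₀ (w t₀))
            (fun t => StairIdx.replace5 (z t) (w t)))) ∧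
    -- (ii) the pencil is singular iff the kernels intersect nontrivially
    (¬ IsRegularPencil (E.map Complex.ofReal) ((J - R).map Complex.ofReal) ↔
      ∃ v : StairIdx n₁ n₂ n₃ n₅ → ℝ, v ≠ 0 ∧ E *ᵥ v = 0 ∧ J *ᵥ v = 0 ∧ R *ᵥ v = 0) ∧
    -- (iii) the Kronecker index
    ((∃! ν : ℕ, IsKroneckerIndex (E.map Complex.ofReal) ((J - R).map Complex.ofReal) ν) ∧
      (IsKroneckerIndex (E.map Complex.ofReal) ((J - R).map Complex.ofReal) 0 ↔
        n₁ = 0 ∧ n₃ = 0) ∧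
      (IsKroneckerIndex (E.map Complex.ofReal) ((J - R).map Complex.ofReal) 1 ↔
        n₁ = 0 ∧ 0 < n₃) ∧
      (IsKroneckerIndex (E.map Complex.ofReal) ((J - R).map Complex.ofReal) 2 ↔ 0 < n₁) ∧
      ∀ ν : ℕ, IsKroneckerIndex (E.map Complex.ofReal) ((J - R).map Complex.ofReal) ν →
        ν ≤ 2) := by
  obtain ⟨k, b, hb⟩ := hS.hasKroneckerForm
  have hex : IsKroneckerIndex (E.map Complex.ofReal) ((J - R).map Complex.ofReal) _ :=
    ⟨k, b, hb, rfl⟩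
  generalize Finset.univ.sup (fun i => (b i).nilpSize) = ν at hex
  have huniq : ∀ ν', IsKroneckerIndex (E.map Complex.ofReal) ((J - R).map Complex.ofReal) ν' →
      ν' = ν := fun ν' h' => by
    have h1 := hS.index_trichotomy hex
    have h2 := hS.index_trichotomy h'
    omega
  have hiff : ∀ ν', IsKroneckerIndex (E.map Complex.ofReal) ((J - R).map Complex.ofReal) ν' ↔
      ν' = ν := fun ν' => ⟨huniq ν', fun h => h ▸ hex⟩
  have hν := hS.index_trichotomy hex
  refine ⟨⟨hS.isUniquelySolvable_iff ht, fun _ z₀ z hz w hw => hS.isIVPSolution_replace5 ht hz hw⟩,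
    hS.toIsDHDAE.not_isRegularPencil_iff, ⟨ν, hex, huniq⟩, ?_, ?_, ?_, fun ν' h' => ?_⟩
  · rw [hiff]; omega
  · rw [hiff]; omega
  · rw [hiff]; omega
  · rw [hiff] at h'; omega
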